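/- Let $V, W$ be finite-dimensional complex vector spaces, $\dim V=n$, and let $A \subset \mathrm{Hom}(V,W) = W\otimes V^*$ be a linear subspace (a tableau). For a basis $(u_i)$ of $V$ with dual basis $(u^i)$, let $s_i$ be the number of linearly independent entries in column $i$ of the matrices $\pi\in A$ that are new relative to columns $1,\dots,i-1$; the basis is generic if $(s_1,\dots,s_n)$ is lexicographically maximal, and then the $s_i$ are the Cartan characters of $A$. Let $\ell$ be the largest index with $s_\ell>0$ ($\ell=0$ if $A=0$), $U=\langle u_1,\dots,u_\ell\rangle$, $Y=\langle u_{\ell+1},\dots,u_n\rangle$, so that $Y^\perp=\langle u^1,\dots,u^\ell\rangle$ and $V^*=Y^\perp\oplus U^\perp$. The tableau is involutive if $s_1+2s_2+\dots+ns_n=\dim A^{(1)}$, where $A^{(1)}=\ker(A\otimes V^*\to W\otimes\wedge^2V^*)$. The characteristic variety is $$\Xi=\{[\xi]\in\mathbb{P}V^* : w\otimes\xi\in A \text{ for some } w\in W,\ w\ne0\},$$ and $\hat\Xi\subset V^*$ is its affine cone (including $0$). A basis $(z_a)$ of $W$ is generic (relative to $(u_i)$) if the entries $\pi^a_i$ with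 $a\le s_i$ form a basis of $A^*$. For $\varphi\in V^*$, $w\in W$, let $\mathsf{B}(\varphi)(\cdot)w$ be the unique element of $A$ whose entries with $a\le s_i$ are $\varphi_iw^a$; this defines endomorphisms $\mathsf{B}(\varphi)(v)$ of $W$. The generic bases are endovolutive if $\mathsf{B}(u^\lambda)(u_i)$ maps $W$ into $\langle z_1,\dots,z_{s_\lambda}\rangle$ for all $\lambda, i$. For $0\ne\varphi\in Y^\perp$ let $W^-(\varphi)=\langle z_1,\dots,z_{s_\lambda}\rangle$ with $\lambda$ the smallest index with $\varphi_\lambda\neq0$, and $W^1(\varphi)=\{w\in W^-(\varphi):\mathsf{B}(\varphi)(u_\mu)w=\varphi_\mu w \text{ for all } \mu\le\ell\}$. **Theorem.** Suppose that $A$ is involutive, and let $(u_i)$ be any generic basis of $V$. 1. There is a basis $(z_a)$ of $W$ such that $(u_i),(z_a)$ are generic endovolutive bases; and for all such $(z_a)$ and every nonzero $\varphi\in Y^\perp$ there is a nonzero $w\in W^1(\varphi)$ that is an eigenvector of $\mathsf{B}(\varphi)(v)$ for every $v\in V$. 2. No point of $\Xi$ lies in $\mathbb{P}U^\perp$, and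 the map $\Xi\to\mathbb{P}Y^\perp$ induced by the projection $V^*=Y^\perp\oplus U^\perp\to Y^\perp$ is onto. 3. This map of projective varieties is a finite branched cover: it is a finite surjective morphism, with finite fibers, and over the standard affine charts of $\mathbb{P}Y^\perp$ it is étale over a dense open subset (all with reduced variety structures). 4. Both $\hat\Xi$ and $Y^\perp$ have dimension $\ell$. In particular, if $A\neq0$ is involutive, then $\Xi$ is nonempty. -/

import Mathlib

open scoped LinearAlgebra.Projectivization

noncomputable section

namespace Tableau

universe uV uW

variable {V : Type uV} {W : Type uW} [AddCommGroup V] [Module ℂ V] [AddCommGroup W] [Module ℂ W]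

/-! ### Tableaux, Cartan characters, involutivity

A tableau is a linear subspace `A` of `V →ₗ[ℂ] W`.  A basis `u` of `V` (indexed from `0`) is used
together with its dual basis of the dual space; the `i`-th column of `π` is `π (u i)`. -/

/-- The first `k` columns of an element of the tableau, in the basis `u`. -/
def firstColumns (A : Submodule ℂ (V →ₗ[ℂ] W)) {n : ℕ} (u : Module.Basis (Fin n) ℂ V) (k : ℕ) :
    A →ₗ[ℂ] ({i : Fin n // i.val < k} → W) :=
  LinearMap.pi fun i => (LinearMap.applyₗ (u i.1)).comp A.subtype

/-- The number of linearly independent entries in the first `k` columns. -/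
def columnRank (A : Submodule ℂ (V →ₗ[ℂ] W)) {n : ℕ} (u : Module.Basis (Fin n) ℂ V) (k : ℕ) : ℕ :=
  Module.finrank ℂ (LinearMap.range (firstColumns A u k))

/-- The number of new independent entries in each column, in the basis `u`. -/
def characters (A : Submodule ℂ (V →ₗ[ℂ] W)) {n : ℕ} (u : Module.Basis (Fin n) ℂ V) (i : Fin n) :
    ℕ :=
  columnRank A u (i.val + 1) - columnRank A u i.val

/-- A basis is generic if its tuple of characters is the lexicographic maximum over all bases.
For a generic `u`, `characters A u` is the tuple of Cartan characters of `A`. -/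
def IsGenericBasis (A : Submodule ℂ (V →ₗ[ℂ] W)) {n : ℕ} (u : Module.Basis (Fin n) ℂ V) : Prop :=
  ∀ u' : Module.Basis (Fin n) ℂ V, toLex (characters A u') ≤ toLex (characters A u)

/-- The number `ℓ` of the last column with a new independent entry (`0` if there is none).
For a generic `u` it is the character of `A`. -/
def lastColumn (A : Submodule ℂ (V →ₗ[ℂ] W)) {n : ℕ} (u : Module.Basis (Fin n) ℂ V) : ℕ :=
  (Finset.univ.filter fun i : Fin n => 0 < characters A u i).sup fun i => i.val + 1

/-- The first prolongation: the kernel of the skewing map from `A ⊗ V*` to `W ⊗ Λ²V*`. -/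
def prolongation (A : Submodule ℂ (V →ₗ[ℂ] W)) : Submodule ℂ (V →ₗ[ℂ] V →ₗ[ℂ] W) where
  carrier := {P | (∀ v, P v ∈ A) ∧ ∀ v v', P v v' = P v' v}
  add_mem' := by
    rintro P Q ⟨hP, hP'⟩ ⟨hQ, hQ'⟩
    refine ⟨fun v => A.add_mem (hP v) (hQ v), fun v v' => ?_⟩
    simp only [LinearMap.add_apply, hP' v v', hQ' v v']
  zero_mem' := ⟨fun _ => A.zero_mem, fun _ _ => rfl⟩
  smul_mem' := by
    rintro c P ⟨hP, hP'⟩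
    refine ⟨fun v => A.smul_mem c (hP v), fun v v' => ?_⟩
    simp only [LinearMap.smul_apply, hP' v v']

/-- Cartan's test: `s₁ + 2 s₂ + ⋯ + n sₙ` equals the dimension of the prolongation, where the `sᵢ`
are the Cartan characters. -/
def IsInvolutive (A : Submodule ℂ (V →ₗ[ℂ] W)) : Prop :=
  ∃ (n : ℕ) (u : Module.Basis (Fin n) ℂ V), IsGenericBasis A u ∧
    ∑ i : Fin n, (i.val + 1) * characters A u i = Module.finrank ℂ (prolongation A)

/-! ### The symbol endomorphisms -/

/-- The upper-left entries `π^a_i`, `a < s_i`, of an element of the tableau. -/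
def upperLeft (A : Submodule ℂ (V →ₗ[ℂ] W)) {n r : ℕ} (u : Module.Basis (Fin n) ℂ V)
    (z : Module.Basis (Fin r) ℂ W) :
    A →ₗ[ℂ] ({p : Fin n × Fin r // p.2.val < characters A u p.1} → ℂ) :=
  LinearMap.pi fun p => (z.coord p.1.2).comp ((LinearMap.applyₗ (u p.1.1)).comp A.subtype)

/-- The pair of bases is generic: `u` is generic, and the upper-left entries form a basis of the
dual space of `A`, that is, they are linear coordinates on `A`. -/
structure IsGenericPair (A : Submodule ℂ (V →ₗ[ℂ] W)) {n r : ℕ} (u : Module.Basis (Fin n) ℂ V)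
    (z : Module.Basis (Fin r) ℂ W) : Prop where
  generic : IsGenericBasis A u
  bijective : Function.Bijective (upperLeft A u z)

section GenericPair

variable {A : Submodule ℂ (V →ₗ[ℂ] W)} {n r : ℕ} {u : Module.Basis (Fin n) ℂ V}
  {z : Module.Basis (Fin r) ℂ W}

/-- The element of the tableau whose upper-left entries are `φ_i w^a`; it is linear in `w`. -/
def fill (h : IsGenericPair A u z) (φ : Module.Dual ℂ V) : W →ₗ[ℂ] A :=
  (LinearEquiv.ofBijective (upperLeft A u z) h.bijective).symm.toLinearMap.comp
    (LinearMap.pi fun p => φ (u p.1.1) • z.coord p.1.2)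

/-- The endomorphism `B(φ)(v)` of `W`: the element of the tableau with upper-left entries
`φ_i w^a`, applied to `v`.  The lower-right entries of that element are given by the symbol
relations `π^a_i = ∑ B^{a,λ}_{i,b} π^b_λ`, so that this is contraction with
`∑_{a ≤ s_i} δ^λ_i δ^a_b (z_a ⊗ z^b) ⊗ (u^i ⊗ u_λ)
  + ∑_{a > s_i} B^{a,λ}_{i,b} (z_a ⊗ z^b) ⊗ (u^i ⊗ u_λ)`. -/
def symbolEnd (h : IsGenericPair A u z) (φ : Module.Dual ℂ V) (v : V) : Module.End ℂ W :=
  (LinearMap.applyₗ v).comp (A.subtype.comp (fill h φ))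

/-- The symbol coefficient `B^{a,λ}_{i,b}` at `a ≥ s_i` (indices from `0`): the coefficient of
`π^b_λ` in the expression of `π^a_i`. -/
def symbolCoeff (h : IsGenericPair A u z) (a : Fin r) (i : Fin n)
    (p : {p : Fin n × Fin r // p.2.val < characters A u p.1}) : ℂ :=
  z.coord a (((LinearEquiv.ofBijective (upperLeft A u z) h.bijective).symm (Pi.single p 1)).1 (u i))

/-- The symbol relations. -/
theorem symbol_relation (h : IsGenericPair A u z) (π : A) (a : Fin r) (i : Fin n) :
    z.coord a (π.1 (u i)) = ∑ p, symbolCoeff h a i p * upperLeft A u z π p := by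
  set e := LinearEquiv.ofBijective (upperLeft A u z) h.bijective with he
  have h1 : π = e.symm (upperLeft A u z π) := by
    rw [LinearEquiv.eq_symm_apply]; rfl
  have h2 : upperLeft A u z π = ∑ p, upperLeft A u z π p • Pi.single p (1 : ℂ) := by
    funext q
    simp [Finset.sum_apply, Pi.single_apply]
  conv_lhs => rw [h1, h2]
  simp only [map_sum, map_smul, Submodule.coe_sum, Submodule.coe_smul, LinearMap.sum_apply,
    LinearMap.smul_apply, smul_eq_mul]
  exact Finset.sum_congr rfl fun p _ => mul_comm _ _

/-- The entries of `B(φ)(u_i) w`: an upper-left entry is `φ_i w^a`, a lower-right one is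
`∑ B^{a,λ}_{i,b} φ_λ w^b`. -/
theorem symbolEnd_entry (h : IsGenericPair A u z) (φ : Module.Dual ℂ V) (i : Fin n) (w : W)
    (a : Fin r) :
    z.coord a (symbolEnd h φ (u i) w) =
      if a.val < characters A u i then φ (u i) * z.coord a w
      else ∑ p, symbolCoeff h a i p * (φ (u p.1.1) * z.coord p.1.2 w) := by
  have key : upperLeft A u z (fill h φ w) = fun p => φ (u p.1.1) * z.coord p.1.2 w :=
    (LinearEquiv.ofBijective (upperLeft A u z) h.bijective).apply_symm_apply _
  split_ifs with ha
  · exact congrFun key ⟨(i, a), ha⟩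
  · have := symbol_relation h (fill h φ w) a i
    rw [key] at this
    exact this

end GenericPair

/-- The span of the first `k` vectors of the basis `z` of `W`. -/
def initialSpan {r : ℕ} (z : Module.Basis (Fin r) ℂ W) (k : ℕ) : Submodule ℂ W :=
  Submodule.span ℂ (z '' {a | a.val < k})

/-- Generic bases are endovolutive if `B(u^λ)(u_i)` is supported on and maps into
`W⁻_λ = ⟨z_a : a < s_λ⟩`.  (The support condition always holds.) -/
def IsEndovolutive {A : Submodule ℂ (V →ₗ[ℂ] W)} {n r : ℕ} {u : Module.Basis (Fin n) ℂ V}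
    {z : Module.Basis (Fin r) ℂ W} (h : IsGenericPair A u z) : Prop :=
  ∀ (l i : Fin n) (w : W), symbolEnd h (u.coord l) (u i) w ∈ initialSpan z (characters A u l)

/-- `W⁻(φ)`: the space `⟨z_a : a < s_λ⟩` for the first index `λ` with `φ_λ ≠ 0`. -/
def wMinus (A : Submodule ℂ (V →ₗ[ℂ] W)) {n r : ℕ} (u : Module.Basis (Fin n) ℂ V)
    (z : Module.Basis (Fin r) ℂ W) (φ : Module.Dual ℂ V) : Submodule ℂ W :=
  ⨅ (l : Fin n) (_ : φ (u l) ≠ 0 ∧ ∀ m < l, φ (u m) = 0), initialSpan z (characters A u l)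

/-- `W¹(φ)`: the vectors `w` of `W⁻(φ)` with `B(φ)(u_μ) w = φ_μ w` for the first `ℓ` indices. -/
def wOne {A : Submodule ℂ (V →ₗ[ℂ] W)} {n r : ℕ} {u : Module.Basis (Fin n) ℂ V}
    {z : Module.Basis (Fin r) ℂ W} (h : IsGenericPair A u z) (φ : Module.Dual ℂ V) :
    Submodule ℂ W :=
  wMinus A u z φ ⊓ ⨅ (m : Fin n) (_ : m.val < lastColumn A u),
    LinearMap.ker (symbolEnd h φ (u m) - φ (u m) • (1 : Module.End ℂ W))

/-! ### The characteristic variety and its projection -/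

/-- The characteristic variety: the projection to `ℙ V*` of the rank-one elements `w ⊗ ξ` of the
tableau. -/
def charVariety (A : Submodule ℂ (V →ₗ[ℂ] W)) : Set (ℙ ℂ (Module.Dual ℂ V)) :=
  {p | ∃ w : W, w ≠ 0 ∧ p.rep.smulRight w ∈ A}

/-- `Y`, the span of the basis vectors after the first `ℓ`. -/
def ySpace (A : Submodule ℂ (V →ₗ[ℂ] W)) {n : ℕ} (u : Module.Basis (Fin n) ℂ V) : Submodule ℂ V :=
  Submodule.span ℂ (u '' {i | lastColumn A u ≤ i.val})

/-- `Y^⊥ = ⟨u^1, …, u^ℓ⟩`. -/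
abbrev yPerp (A : Submodule ℂ (V →ₗ[ℂ] W)) {n : ℕ} (u : Module.Basis (Fin n) ℂ V) :
    Submodule ℂ (Module.Dual ℂ V) :=
  (ySpace A u).dualAnnihilator

/-- The projection of `V` to `U = ⟨u_1, …, u_ℓ⟩` with kernel `Y`, as an endomorphism of `V`. -/
def uProj (A : Submodule ℂ (V →ₗ[ℂ] W)) {n : ℕ} (u : Module.Basis (Fin n) ℂ V) : V →ₗ[ℂ] V :=
  u.constr ℂ fun i => if i.val < lastColumn A u then u i else 0

theorem uProj_of_mem_ySpace (A : Submodule ℂ (V →ₗ[ℂ] W)) {n : ℕ} (u : Module.Basis (Fin n) ℂ V)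
    {y : V} (hy : y ∈ ySpace A u) : uProj A u y = 0 := by
  have : ySpace A u ≤ LinearMap.ker (uProj A u) := by
    refine Submodule.span_le.2 ?_
    rintro _ ⟨i, hi, rfl⟩
    have hi' : lastColumn A u ≤ i.val := hi
    rw [SetLike.mem_coe, LinearMap.mem_ker, uProj, Module.Basis.constr_basis, if_neg (not_lt.2 hi')]
  exact this hy

/-- The projection of `V* = Y^⊥ ⊕ U^⊥` to `Y^⊥`, namely `∑ ξ_i u^i ↦ ∑_{i ≤ ℓ} ξ_i u^i`. -/
def dualProj (A : Submodule ℂ (V →ₗ[ℂ] W)) {n : ℕ} (u : Module.Basis (Fin n) ℂ V) :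
    Module.Dual ℂ V →ₗ[ℂ] yPerp A u :=
  (uProj A u).dualMap.codRestrict _ fun ξ => by
    rw [Submodule.mem_dualAnnihilator]
    intro y hy
    simp [LinearMap.dualMap_apply, uProj_of_mem_ySpace A u hy]

end Tableau

/-! ### Finite branched covers of projective spaces by linear projection -/

namespace ProjectiveCover

universe uE uF

variable {E : Type uE} {F : Type uF} [AddCommGroup E] [Module ℂ E] [AddCommGroup F] [Module ℂ F]

/-- The affine cone over a set in projective space (it contains `0`). -/
def affineCone (Z : Set (ℙ ℂ E)) : Set E :=
  {x | ∀ h : x ≠ 0, Projectivization.mk ℂ x h ∈ Z}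

/-- The ring of polynomial functions on a subset `X` of a vector space: for an affine algebraic
set `X` it is the coordinate ring of `X` as a (reduced) variety. -/
def polyFun (X : Set E) : Subalgebra ℂ (X → ℂ) :=
  Algebra.adjoin ℂ (Set.range fun (l : Module.Dual ℂ E) (x : X) => l x.1)

/-- Pull-back of polynomial functions by a linear map. -/
def pullback (L : E →ₗ[ℂ] F) {X : Set E} {Y : Set F} (h : Set.MapsTo L X Y) :
    polyFun Y →ₐ[ℂ] polyFun X :=
  let c : (Y → ℂ) →ₐ[ℂ] (X → ℂ) := AlgHom.pi fun x => Pi.evalAlgHom ℂ (fun _ : Y => ℂ) (h.restrict L X Y x)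
  (c.comp (polyFun Y).val).codRestrict (polyFun X) (by
    have : polyFun Y ≤ (polyFun X).comap c := by
      refine Algebra.adjoin_le ?_
      rintro _ ⟨l, rfl⟩
      exact Algebra.subset_adjoin ⟨l.comp L, rfl⟩
    exact fun f => this f.2)

@[simp]
theorem pullback_apply (L : E →ₗ[ℂ] F) {X : Set E} {Y : Set F} (h : Set.MapsTo L X Y)
    (f : polyFun Y) (x : X) : (pullback L h f).1 x = f.1 ⟨L x.1, h x.2⟩ := rfl

/-- The part of `Z` in the affine chart `l ≠ 0`, each point being represented by its unique
representative with `l x = 1`. -/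
def chart (Z : Set (ℙ ℂ E)) (l : Module.Dual ℂ E) : Set E :=
  {x | x ∈ affineCone Z ∧ l x = 1}

/-- `Z` does not meet the centre of the linear projection `L`. -/
def AvoidsKernel (Z : Set (ℙ ℂ E)) (L : E →ₗ[ℂ] F) : Prop :=
  ∀ p ∈ Z, L p.rep ≠ 0

/-- The map from `Z` to the projective space of `F` that is induced by `L`. -/
def linearProjection {Z : Set (ℙ ℂ E)} {L : E →ₗ[ℂ] F} (h : AvoidsKernel Z L) : Z → ℙ ℂ F :=
  fun p => Projectivization.mk ℂ (L p.1.rep) (h p.1 p.2)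

theorem chart_mapsTo (Z : Set (ℙ ℂ E)) (L : E →ₗ[ℂ] F) (l : Module.Dual ℂ F) :
    Set.MapsTo L (chart Z (l.comp L)) (chart Set.univ l) :=
  fun _ hx => ⟨fun _ => Set.mem_univ _, hx.2⟩

/-- The map from the projective variety `Z` to the projective space of `F` that is induced by `L` is
a finite branched cover: it is onto with finite fibres, it is a finite morphism (over each of the
affine charts `l ≠ 0` of the target, the coordinate ring of the source is a finite module over that
of the target), and it is unbranched (étale) over a dense open part `Δ ≠ 0` of each chart. -/
structure IsFiniteBranchedCover {Z : Set (ℙ ℂ E)} {L : E →ₗ[ℂ] F} (h : AvoidsKernel Z L) :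
    Prop where
  surjective : Function.Surjective (linearProjection h)
  finite_fibers : ∀ q : ℙ ℂ F, (linearProjection h ⁻¹' {q}).Finite
  finite : ∀ l : Module.Dual ℂ F, l ≠ 0 → (pullback L (chart_mapsTo Z L l)).toRingHom.Finite
  generically_etale : ∀ l : Module.Dual ℂ F, l ≠ 0 → ∃ Δ : polyFun (chart Set.univ l), Δ ≠ 0 ∧
    RingHom.Etale (R := Localization.Away Δ)
      (S := Localization.Away ((pullback L (chart_mapsTo Z L l)).toRingHom Δ))
      (Localization.awayMap (pullback L (chart_mapsTo Z L l)).toRingHom Δ)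

end ProjectiveCover

end

/-! Let `A_i` be the elements of `A` whose columns before column `i` vanish. Abel summation turns
Cartan's number `∑ (i+1) s_i` (indices from zero) into `∑ dim A_i`. The prolongation has a parallel
filtration: if the slices `P(u_j)`, `j < i`, vanish, then by symmetry `P(u_i)` lies in `A_i`, and
`dim A^(1)` is the sum of the dimensions of these images. Cartan's test is therefore equality in a
termwise bound: every `π ∈ A_i` is `P(u_i)` for a symmetric `P` with values in `A_i`
(`map_prolongationTail`, `exists_symmetric_family`). It follows that the column spaces decrease with
`i`, and a basis of `W` adapted to this flag is endovolutive.

At the last index `m` with `s_m > 0`, evaluation at `u_m` is injective on `A_m`. The symmetric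
families then make the operators `π(u_m) ↦ π(v)` well defined and commuting, and a common
eigenvector is a rank one element `w ⊗ ξ` (`exists_smulRight_mem`). This reaches only the covector
`u^m` of `Y^⊥`. A transvection moves the other coordinates to any prescribed values, and genericity
survives for all but finitely many values `τ` of the last coordinate. The exceptional `τ` are
recovered by compactness of the unit sphere (`exists_common_eigenvector_of_finite`), so rank one
elements exist over all of `Y^⊥`.

Conversely, if `w ⊗ ξ ∈ A` lies over `φ`, then `B(φ)(v) w = ξ(v) w`. Each coordinate `ξ_i` is thus a
root of the characteristic polynomial of `B(φ)(u_i)`, which is linear in `φ`. This gives the empty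
intersection with the centre, finite fibres and integrality. Generic étaleness holds for finite
reduced algebras over a Noetherian domain of characteristic zero, and the dimension follows from an
injective integral extension. -/

noncomputable section

/-! ### Commutative algebra: generic étaleness and Krull dimension of integral extensions -/

section CommutativeAlgebra

universe uR

/-- A finite reduced algebra over a field of characteristic zero is formally étale. -/
theorem Algebra.FormallyEtale.of_finite_of_isReduced {K S : Type uR} [Field K] [CharZero K]
    [CommRing S] [Algebra K S] [Module.Finite K S] [IsReduced S] : Algebra.FormallyEtale K S := by
  have : IsArtinianRing S := IsArtinianRing.of_finite K S
  have : ∀ I : MaximalSpectrum S, Algebra.FormallyEtale K (S ⧸ I.asIdeal) := by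
    intro I
    let := Ideal.Quotient.field I.asIdeal
    exact Algebra.FormallyEtale.of_isSeparable K (S ⧸ I.asIdeal)
  exact .of_equiv ((IsArtinianRing.equivPi S).restrictScalars K).symm

/-- A finite reduced algebra over a domain of characteristic zero is étale at the points over the
generic point. -/
theorem Algebra.isEtaleAt_of_under_eq_bot {R S : Type uR} [CommRing R] [IsDomain R] [CharZero R]
    [CommRing S] [IsReduced S] [Algebra R S] [Module.Finite R S] (q : Ideal S) [q.IsPrime]
    (hq : q.comap (algebraMap R S) = ⊥) : Algebra.IsEtaleAt R q := by
  -- Inverting the nonzero elements of `R` makes `S` a finite reduced algebra `T` over the fraction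
  -- field, hence formally étale. The local ring at `q` is a further localization of `T`.
  let M : Submonoid S := Algebra.algebraMapSubmonoid S (nonZeroDivisors R)
  let K := FractionRing R
  let T := Localization M
  have : CharZero K := charZero_of_injective_algebraMap (IsFractionRing.injective R K)
  let : Algebra K T := localizationAlgebra (nonZeroDivisors R) S
  have : IsScalarTower R K T := isScalarTower_localizationAlgebra
    (nonZeroDivisors R) S
  have : Module.Finite K T := Module.Finite.of_isLocalization R S (nonZeroDivisors R)
  have : IsReduced T := isReduced_localizationPreserves M T inferInstance
  have : Algebra.FormallyEtale K T := .of_finite_of_isReduced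
  have : Algebra.FormallyEtale R K := .of_isLocalization (nonZeroDivisors R)
  have : Algebra.FormallyEtale R T := .comp R K T
  have hM : M ≤ q.primeCompl := by
    rintro _ ⟨r, hr, rfl⟩ hrq
    have : r ∈ q.comap (algebraMap R S) := hrq
    rw [hq, Ideal.mem_bot] at this
    exact nonZeroDivisors.ne_zero hr this
  let : Algebra T (Localization.AtPrime q) :=
    IsLocalization.localizationAlgebraOfSubmonoidLe T (Localization.AtPrime q) M q.primeCompl hM
  have : IsScalarTower S T (Localization.AtPrime q) :=
    IsLocalization.localization_isScalarTower_of_submonoid_le _ _ _ _ hM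
  have : IsLocalization (q.primeCompl.map (algebraMap S T)) (Localization.AtPrime q) :=
    IsLocalization.isLocalization_of_submonoid_le _ _ _ _ hM
  have : IsScalarTower R T (Localization.AtPrime q) :=
    IsScalarTower.of_algebraMap_eq fun r => by
      rw [IsScalarTower.algebraMap_apply R S T, ← IsScalarTower.algebraMap_apply S T,
        ← IsScalarTower.algebraMap_apply R S]
  have : Algebra.FormallyEtale T (Localization.AtPrime q) :=
    .of_isLocalization (q.primeCompl.map (algebraMap S T))
  exact Algebra.FormallyEtale.comp R T (Localization.AtPrime q)

/-- A finite morphism from a reduced scheme to an integral Noetherian affine scheme of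
characteristic zero is étale over a nonempty basic open subset. -/
theorem RingHom.Finite.exists_etale_awayMap {R S : Type uR} [CommRing R] [IsDomain R] [CharZero R]
    [IsNoetherianRing R] [CommRing S] [IsReduced S] (f : R →+* S) (hf : f.Finite) :
    ∃ Δ : R, Δ ≠ 0 ∧ RingHom.Etale (R := Localization.Away Δ) (S := Localization.Away (f Δ))
      (Localization.awayMap f Δ) := by
  algebraize [f]
  have hfp : Algebra.FinitePresentation R S :=
    Algebra.FinitePresentation.of_finiteType.1 inferInstance
  -- Integral maps are closed, so the image of the non-étale locus is closed. It misses the generic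
  -- point, hence some nonzero `Δ` vanishes on it.
  have hclosed : IsClosed (PrimeSpectrum.comap f '' (Algebra.etaleLocus R S)ᶜ) :=
    PrimeSpectrum.isClosedMap_comap_of_isIntegral f hf.to_isIntegral _
      Algebra.isOpen_etaleLocus.isClosed_compl
  obtain ⟨I, hI⟩ := (PrimeSpectrum.isClosed_iff_zeroLocus_ideal _).1 hclosed
  have hbot : I ≠ ⊥ := by
    rintro rfl
    have : (⟨⊥, Ideal.isPrime_bot⟩ : PrimeSpectrum R) ∈ PrimeSpectrum.zeroLocus
        ((⊥ : Ideal R) : Set R) := by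
      rw [PrimeSpectrum.mem_zeroLocus]
    rw [← hI] at this
    obtain ⟨q, hq, hq'⟩ := this
    exact hq (Algebra.isEtaleAt_of_under_eq_bot q.asIdeal (congrArg PrimeSpectrum.asIdeal hq'))
  obtain ⟨Δ, hΔ, hΔ0⟩ := Submodule.exists_mem_ne_zero_of_ne_bot hbot
  refine ⟨Δ, hΔ0, ?_⟩
  have het : Algebra.Etale R (Localization.Away (f Δ)) := by
    refine Algebra.basicOpen_subset_etaleLocus_iff_etale.1 fun q hq => ?_
    by_contra hq'
    have : PrimeSpectrum.comap f q ∈ PrimeSpectrum.zeroLocus (I : Set R) :=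
      hI ▸ Set.mem_image_of_mem _ hq'
    exact hq (this hΔ)
  let : Algebra (Localization.Away Δ) (Localization.Away (f Δ)) :=
    (Localization.awayMap f Δ).toAlgebra
  have : IsScalarTower R (Localization.Away Δ) (Localization.Away (f Δ)) :=
    IsScalarTower.of_algebraMap_eq fun r => by
      rw [RingHom.algebraMap_toAlgebra (Localization.awayMap f Δ)]
      simp only [Localization.awayMap, IsLocalization.Away.map, IsLocalization.map_eq]
      rfl
  have : Algebra.Etale R (Localization.Away Δ) := .of_isLocalizationAway Δ
  exact Algebra.Etale.of_restrictScalars R (Localization.Away Δ) (Localization.Away (f Δ))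

/-- An injective integral ring homomorphism preserves the Krull dimension. -/
theorem RingHom.IsIntegral.ringKrullDim_eq {R S : Type*} [CommRing R] [CommRing S] (f : R →+* S)
    (hf : f.IsIntegral) (hinj : Function.Injective f) : ringKrullDim S = ringKrullDim R := by
  algebraize [f]
  have : Algebra.IsIntegral R S := ⟨hf⟩
  apply le_antisymm
  · refine Order.krullDim_le_of_strictMono (PrimeSpectrum.comap f) fun p q hpq => ?_
    exact Ideal.IsIntegral.comap_lt_comap (R := R) hpq
  · refine iSup_le fun l => ?_
    obtain ⟨Q, -, hQ, hQl⟩ := Ideal.exists_ideal_over_prime_of_isIntegral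
      (S := S) l.head.asIdeal ⊥ (by
        rw [Ideal.comap_bot_of_injective (algebraMap R S) hinj]; exact bot_le)
    have : Q.LiesOver l.head.asIdeal := ⟨hQl.symm⟩
    obtain ⟨L, hL, -⟩ := Ideal.exists_ltSeries_of_hasGoingUp l Q
    rw [← hL]
    exact le_iSup (fun p : LTSeries (PrimeSpectrum S) => (p.length : WithBot ℕ∞)) L

end CommutativeAlgebra

end

noncomputable section

/-! ### Rings of polynomial functions -/

namespace ProjectiveCover

variable {E : Type*} {F : Type*} [AddCommGroup E] [Module ℂ E] [AddCommGroup F] [Module ℂ F]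

/-- The polynomial function on `X` that is defined by a linear form. -/
def linearFun (X : Set E) (l : Module.Dual ℂ E) : polyFun X :=
  ⟨fun x => l x.1, Algebra.subset_adjoin ⟨l, rfl⟩⟩

@[simp]
theorem linearFun_apply (X : Set E) (l : Module.Dual ℂ E) (x : X) : (linearFun X l).1 x = l x.1 :=
  rfl

/-- Evaluation of polynomial functions at a point. -/
def evalAt (X : Set E) (x : X) : polyFun X →ₐ[ℂ] ℂ :=
  (Pi.evalAlgHom ℂ (fun _ : X => ℂ) x).comp (polyFun X).val

@[simp]
theorem evalAt_apply (X : Set E) (x : X) (f : polyFun X) : evalAt X x f = f.1 x := rfl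

theorem adjoin_linearFun_basis (X : Set E) {ι : Type*} [Finite ι]
    (b : Module.Basis ι ℂ (Module.Dual ℂ E)) :
    Algebra.adjoin ℂ (Set.range fun i => linearFun X (b i)) = ⊤ := by
  cases nonempty_fintype ι
  have hlin : ∀ l, linearFun X l ∈ Algebra.adjoin ℂ (Set.range fun i => linearFun X (b i)) := by
    intro l
    have : linearFun X l = ∑ i, b.repr l i • linearFun X (b i) := by
      apply Subtype.ext
      funext x
      have h := LinearMap.congr_fun (b.sum_repr l) x.1
      rw [LinearMap.sum_apply] at h
      simpa using h.symm
    rw [this]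
    exact Subalgebra.sum_mem _ fun i _ =>
      Subalgebra.smul_mem _ (Algebra.subset_adjoin (Set.mem_range_self i)) _
  rw [eq_top_iff]
  rintro ⟨f, hf⟩ -
  induction hf using Algebra.adjoin_induction with
  | mem f hf =>
    obtain ⟨l, rfl⟩ := hf
    exact hlin l
  | algebraMap c => exact Subalgebra.algebraMap_mem _ c
  | add f g hf hg hf' hg' => exact Subalgebra.add_mem _ hf' hg'
  | mul f g hf hg hf' hg' => exact Subalgebra.mul_mem _ hf' hg'

instance (X : Set E) [FiniteDimensional ℂ E] : Algebra.FiniteType ℂ (polyFun X) := by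
  let b := Module.finBasis ℂ (Module.Dual ℂ E)
  refine ⟨⟨(Set.finite_range fun i => linearFun X (b i)).toFinset, ?_⟩⟩
  rw [Set.Finite.coe_toFinset]
  exact adjoin_linearFun_basis X b

instance (X : Set E) [FiniteDimensional ℂ E] : IsNoetherianRing (polyFun X) :=
  Algebra.FiniteType.isNoetherianRing ℂ _

instance (X : Set E) : IsReduced (polyFun X) :=
  isReduced_of_injective (polyFun X).val Subtype.val_injective

instance (X : Set E) [Nonempty X] : Nontrivial (polyFun X) :=
  (polyFun X).val.toRingHom.domain_nontrivial

instance (X : Set E) [Nonempty X] : CharZero (polyFun X) :=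
  charZero_of_injective_algebraMap (algebraMap ℂ (polyFun X)).injective

/-- A polynomial function restricts to a polynomial on a line that lies in `X`. -/
theorem exists_polynomial_on_line {X : Set E} {a b : E} (h : ∀ t : ℂ, a + t • b ∈ X)
    (f : polyFun X) : ∃ p : Polynomial ℂ, ∀ t, f.1 ⟨a + t • b, h t⟩ = p.eval t := by
  obtain ⟨f, hf⟩ := f
  induction hf using Algebra.adjoin_induction with
  | mem f hf =>
    obtain ⟨l, rfl⟩ := hf
    exact ⟨Polynomial.C (l a) + Polynomial.X * Polynomial.C (l b), fun t => by simp; ring⟩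
  | algebraMap c => exact ⟨Polynomial.C c, fun t => by simp⟩
  | add f g hf hg hf' hg' =>
    obtain ⟨p, hp⟩ := hf'
    obtain ⟨q, hq⟩ := hg'
    refine ⟨p + q, fun t => ?_⟩
    rw [Polynomial.eval_add, ← hp, ← hq]
    rfl
  | mul f g hf hg hf' hg' =>
    obtain ⟨p, hp⟩ := hf'
    obtain ⟨q, hq⟩ := hg'
    refine ⟨p * q, fun t => ?_⟩
    rw [Polynomial.eval_mul, ← hp, ← hq]
    rfl

/-- The polynomial functions on an affine subspace form a domain. -/
theorem noZeroDivisors_polyFun {X : Set E}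
    (h : ∀ a ∈ X, ∀ b ∈ X, ∀ t : ℂ, a + t • (b - a) ∈ X) : NoZeroDivisors (polyFun X) := by
  refine ⟨fun {f g} hfg => ?_⟩
  by_contra! hne
  have hex : ∀ f : polyFun X, f ≠ 0 → ∃ x : X, f.1 x ≠ 0 := by
    intro f hf
    by_contra! h0
    exact hf (Subtype.ext (funext h0))
  obtain ⟨⟨a, ha⟩, hfa⟩ := hex f hne.1
  obtain ⟨⟨b, hb⟩, hgb⟩ := hex g hne.2
  -- On the line through `a` and `b` the product vanishes identically, while `p(0) ≠ 0` and `q(1) ≠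
  -- 0`.
  obtain ⟨p, hp⟩ := exists_polynomial_on_line (h a ha b hb) f
  obtain ⟨q, hq⟩ := exists_polynomial_on_line (h a ha b hb) g
  have hpq : p * q = 0 := by
    refine Polynomial.funext fun t => ?_
    rw [Polynomial.eval_mul, ← hp, ← hq, Polynomial.eval_zero]
    exact congrFun (congrArg Subtype.val hfg) _
  have hp0 := hp 0
  have hq1 := hq 1
  rcases mul_eq_zero.1 hpq with rfl | rfl
  · simp only [zero_smul, add_zero, Polynomial.eval_zero] at hp0
    exact hfa hp0
  · simp only [one_smul, add_sub_cancel, Polynomial.eval_zero] at hq1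
    exact hgb hq1

/-- The dimension of a vector space as an algebraic variety. -/
theorem ringKrullDim_polyFun_univ [FiniteDimensional ℂ E] :
    ringKrullDim (polyFun (Set.univ : Set E)) = Module.finrank ℂ E := by
  let b := Module.finBasis ℂ E
  let Φ : MvPolynomial (Fin (Module.finrank ℂ E)) ℂ →ₐ[ℂ] polyFun (Set.univ : Set E) :=
    MvPolynomial.aeval fun i => linearFun Set.univ (b.dualBasis i)
  have hsurj : Function.Surjective Φ := by
    rw [← AlgHom.range_eq_top, ← Algebra.adjoin_range_eq_range_aeval]
    exact adjoin_linearFun_basis Set.univ b.dualBasis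
  have hinj : Function.Injective Φ := by
    rw [injective_iff_map_eq_zero]
    intro p hp
    refine MvPolynomial.funext fun c => ?_
    have h1 : (evalAt Set.univ ⟨b.equivFun.symm c, trivial⟩) (Φ p) = MvPolynomial.eval c p := by
      have h2 : (evalAt Set.univ ⟨b.equivFun.symm c, trivial⟩).comp Φ = MvPolynomial.aeval c := by
        refine MvPolynomial.algHom_ext fun i => ?_
        simp [Φ, Finsupp.single_apply]
      rw [← AlgHom.comp_apply, h2]
      rfl
    rw [← h1, hp, map_zero, map_zero]
  rw [← ringKrullDim_eq_of_ringEquiv (RingEquiv.ofBijective Φ ⟨hinj, hsurj⟩),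
    MvPolynomial.ringKrullDim_of_isNoetherianRing, ringKrullDim_eq_zero_of_field]
  simp

/-! ### Pullback along a linear map -/

theorem pullback_injective {L : E →ₗ[ℂ] F} {X : Set E} {Y : Set F} (h : Set.MapsTo L X Y)
    (hs : Set.SurjOn L X Y) : Function.Injective (pullback L h) := by
  intro f g hfg
  refine Subtype.ext (funext ?_)
  rintro ⟨y, hy⟩
  obtain ⟨x, hx, rfl⟩ := hs hy
  exact congrFun (congrArg Subtype.val hfg) ⟨x, hx⟩

/-- Integral elements form a subring, so integrality need only be tested on the coordinate
functions; with finite type it gives finiteness. -/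
theorem pullback_finite [FiniteDimensional ℂ E] {L : E →ₗ[ℂ] F} {X : Set E} {Y : Set F}
    (h : Set.MapsTo L X Y) {ι : Type*} [Finite ι] (b : Module.Basis ι ℂ (Module.Dual ℂ E))
    (hb : ∀ i, (pullback L h).toRingHom.IsIntegralElem (linearFun X (b i))) :
    (pullback L h).toRingHom.Finite := by
  refine RingHom.IsIntegral.to_finite ?_ ?_
  · intro f
    have hf : f ∈ Algebra.adjoin ℂ (Set.range fun i => linearFun X (b i)) := by
      rw [adjoin_linearFun_basis]; trivial
    induction hf using Algebra.adjoin_induction with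
    | mem f hf =>
      obtain ⟨i, rfl⟩ := hf
      exact hb i
    | algebraMap c =>
      have : algebraMap ℂ (polyFun X) c = (pullback L h).toRingHom (algebraMap ℂ _ c) :=
        ((pullback L h).commutes c).symm
      rw [this]
      exact RingHom.isIntegralElem_map _
    | add f g _ _ hf hg => exact RingHom.IsIntegralElem.add _ hf hg
    | mul f g _ _ hf hg => exact RingHom.IsIntegralElem.mul _ hf hg
  · refine RingHom.FiniteType.of_comp_finiteType (f := algebraMap ℂ (polyFun Y)) ?_
    have : (pullback L h).toRingHom.comp (algebraMap ℂ (polyFun Y)) = algebraMap ℂ (polyFun X) :=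
      (pullback L h).comp_algebraMap
    rw [this, RingHom.finiteType_algebraMap]
    infer_instance

theorem chart_univ (l : Module.Dual ℂ F) : chart Set.univ l = {y | l y = 1} := by
  ext y
  exact ⟨fun hy => hy.2, fun hy => ⟨fun _ => trivial, hy⟩⟩

theorem isDomain_polyFun_chart_univ {l : Module.Dual ℂ F} (hl : l ≠ 0) :
    Nonempty (chart Set.univ l) ∧ IsDomain (polyFun (chart Set.univ l)) := by
  obtain ⟨y, hy⟩ : ∃ y, l y ≠ 0 := by
    by_contra! h
    exact hl (LinearMap.ext h)
  have hne : Nonempty (chart Set.univ l) :=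
    ⟨⟨(l y)⁻¹ • y, by rw [chart_univ]; simp [hy]⟩⟩
  have : NoZeroDivisors (polyFun (chart Set.univ l)) := by
    refine noZeroDivisors_polyFun fun a ha b hb t => ?_
    rw [chart_univ] at *
    have ha' : l a = 1 := ha
    have hb' : l b = 1 := hb
    simp [ha', hb']
  exact ⟨hne, NoZeroDivisors.to_isDomain _⟩

end ProjectiveCover

end

noncomputable section

/-! ### Involutive tableaux -/

namespace Tableau

theorem finrank_map_add_finrank_inf_ker {M N : Type*} [AddCommGroup M] [Module ℂ M]
    [FiniteDimensional ℂ M] [AddCommGroup N] [Module ℂ N] (p : Submodule ℂ M) (f : M →ₗ[ℂ] N) :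
    Module.finrank ℂ (p.map f) + Module.finrank ℂ (p ⊓ LinearMap.ker f : Submodule ℂ M) =
      Module.finrank ℂ p := by
  have h := LinearMap.finrank_range_add_finrank_ker (f.domRestrict p)
  rw [LinearMap.range_domRestrict, LinearMap.ker_domRestrict,
    ← Submodule.finrank_map_subtype_eq] at h
  rwa [Submodule.map_comap_subtype] at h

/-- Abel summation, to be applied with `k i` the dimension of the `i`-th tail and `s i` the `i`-th
character. -/
theorem sum_succ_mul_add_mul {k s : ℕ → ℕ} (h : ∀ i, s i + k (i + 1) = k i) (n : ℕ) :
    ∑ i ∈ Finset.range n, (i + 1) * s i + n * k n = ∑ i ∈ Finset.range n, k i := by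
  induction n with
  | zero => simp
  | succ n ih =>
    rw [Finset.sum_range_succ, Finset.sum_range_succ, ← ih]
    have := h n
    nlinarith

theorem sum_add_of_add_succ {p r : ℕ → ℕ} (n : ℕ) (h : ∀ i < n, r i + p (i + 1) = p i) :
    ∑ i ∈ Finset.range n, r i + p n = p 0 := by
  induction n with
  | zero => simp
  | succ n ih =>
    rw [Finset.sum_range_succ, ← ih fun i hi => h i (hi.trans n.lt_succ_self), add_assoc,
      h n n.lt_succ_self]

variable {V : Type*} {W : Type*} [AddCommGroup V] [Module ℂ V] [AddCommGroup W] [Module ℂ W]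
  (A : Submodule ℂ (V →ₗ[ℂ] W)) {n : ℕ} (u : Module.Basis (Fin n) ℂ V)

/-- The elements of the tableau whose first `k` columns vanish. -/
def tailSpace (k : ℕ) : Submodule ℂ (V →ₗ[ℂ] W) :=
  A ⊓ ⨅ (i : Fin n) (_ : i.val < k), LinearMap.ker (LinearMap.applyₗ (u i))

/-- The elements of the prolongation whose first `k` columns vanish. -/
def prolongationTail (k : ℕ) : Submodule ℂ (V →ₗ[ℂ] V →ₗ[ℂ] W) :=
  prolongation A ⊓ ⨅ (i : Fin n) (_ : i.val < k), LinearMap.ker (LinearMap.applyₗ (u i))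

/-- The values in column `i` of the elements of the tableau whose previous columns vanish. -/
def columnSpace (i : Fin n) : Submodule ℂ W :=
  (tailSpace A u i.val).map (LinearMap.applyₗ (u i))

variable {A u}

theorem mem_tailSpace {k : ℕ} {π : V →ₗ[ℂ] W} :
    π ∈ tailSpace A u k ↔ π ∈ A ∧ ∀ i : Fin n, i.val < k → π (u i) = 0 := by
  simp [tailSpace, Submodule.mem_iInf]

theorem mem_prolongationTail {k : ℕ} {P : V →ₗ[ℂ] V →ₗ[ℂ] W} :
    P ∈ prolongationTail A u k ↔ P ∈ prolongation A ∧ ∀ i : Fin n, i.val < k → P (u i) = 0 := by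
  simp [prolongationTail, Submodule.mem_iInf]

theorem mem_columnSpace {i : Fin n} {w : W} :
    w ∈ columnSpace A u i ↔ ∃ π ∈ tailSpace A u i.val, π (u i) = w := Iff.rfl

theorem tailSpace_antitone : Antitone (tailSpace A u) := fun _ _ h _ hπ =>
  mem_tailSpace.2 ⟨(mem_tailSpace.1 hπ).1, fun i hi => (mem_tailSpace.1 hπ).2 i (hi.trans_le h)⟩

theorem tailSpace_succ (i : Fin n) :
    tailSpace A u (i.val + 1) = tailSpace A u i.val ⊓ LinearMap.ker (LinearMap.applyₗ (u i)) := by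
  ext π
  rw [Submodule.mem_inf, mem_tailSpace, mem_tailSpace, LinearMap.mem_ker, and_assoc]
  refine and_congr_right fun _ => ⟨fun h => ⟨fun j hj => h j (hj.trans (Nat.lt_succ_self _)),
    h i (Nat.lt_succ_self _)⟩, fun h j hj => ?_⟩
  rcases Nat.lt_succ_iff_lt_or_eq.1 hj with hj | hj
  · exact h.1 j hj
  · rw [Fin.ext hj]
    exact h.2

theorem prolongationTail_succ (i : Fin n) :
    prolongationTail A u (i.val + 1) =
      prolongationTail A u i.val ⊓ LinearMap.ker (LinearMap.applyₗ (u i)) := by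
  ext π
  rw [Submodule.mem_inf, mem_prolongationTail, mem_prolongationTail, LinearMap.mem_ker, and_assoc]
  refine and_congr_right fun _ => ⟨fun h => ⟨fun j hj => h j (hj.trans (Nat.lt_succ_self _)),
    h i (Nat.lt_succ_self _)⟩, fun h j hj => ?_⟩
  rcases Nat.lt_succ_iff_lt_or_eq.1 hj with hj | hj
  · exact h.1 j hj
  · rw [Fin.ext hj]
    exact h.2

theorem tailSpace_self : tailSpace A u n = ⊥ := by
  rw [eq_bot_iff]
  intro π hπ
  rw [Submodule.mem_bot]
  exact u.ext fun i => by rw [(mem_tailSpace.1 hπ).2 i i.isLt, LinearMap.zero_apply]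

theorem prolongationTail_self : prolongationTail A u n = ⊥ := by
  rw [eq_bot_iff]
  intro P hP
  rw [Submodule.mem_bot]
  exact u.ext fun i => by rw [(mem_prolongationTail.1 hP).2 i i.isLt, LinearMap.zero_apply]

theorem finrank_tailSpace_self : Module.finrank ℂ (tailSpace A u n) = 0 := by
  rw [tailSpace_self, finrank_bot]

theorem finrank_prolongationTail_self : Module.finrank ℂ (prolongationTail A u n) = 0 := by
  rw [prolongationTail_self, finrank_bot]

theorem prolongationTail_zero : prolongationTail A u 0 = prolongation A := by
  ext P
  simp [mem_prolongationTail]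

/-- Symmetry turns the vanishing of `P (u j)` into the vanishing of column `j` of every slice `P v`.
This is the termwise form of Cartan's inequality. -/
theorem map_prolongationTail_le (i : Fin n) :
    (prolongationTail A u i.val).map (LinearMap.applyₗ (u i)) ≤ tailSpace A u i.val := by
  rintro _ ⟨P, hP, rfl⟩
  obtain ⟨⟨hPA, hsymm⟩, h0⟩ := mem_prolongationTail.1 hP
  refine mem_tailSpace.2 ⟨hPA _, fun j hj => ?_⟩
  rw [LinearMap.applyₗ_apply_apply, hsymm, h0 j hj, LinearMap.zero_apply]

/-! ### Dimension counts and Cartan's test -/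

variable [FiniteDimensional ℂ V] [FiniteDimensional ℂ W]

theorem columnRank_add_finrank_tailSpace (k : ℕ) :
    columnRank A u k + Module.finrank ℂ (tailSpace A u k) = Module.finrank ℂ A := by
  have h : tailSpace A u k = (LinearMap.ker (firstColumns A u k)).map A.subtype := by
    ext π
    rw [mem_tailSpace, Submodule.mem_map]
    constructor
    · rintro ⟨hA, hπ⟩
      refine ⟨⟨π, hA⟩, ?_, rfl⟩
      rw [LinearMap.mem_ker]
      funext i
      exact hπ i.1 i.2
    · rintro ⟨π, hπ, rfl⟩
      exact ⟨π.2, fun i hi => congrFun hπ ⟨i, hi⟩⟩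
  rw [h, Submodule.finrank_map_subtype_eq, columnRank]
  exact LinearMap.finrank_range_add_finrank_ker _

theorem finrank_columnSpace_add (i : Fin n) :
    Module.finrank ℂ (columnSpace A u i) + Module.finrank ℂ (tailSpace A u (i.val + 1)) =
      Module.finrank ℂ (tailSpace A u i.val) := by
  rw [tailSpace_succ]
  exact finrank_map_add_finrank_inf_ker _ _

theorem characters_eq (i : Fin n) : characters A u i =
    Module.finrank ℂ (tailSpace A u i.val) - Module.finrank ℂ (tailSpace A u (i.val + 1)) := by
  have h1 := columnRank_add_finrank_tailSpace (A := A) (u := u) i.val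
  have h2 := columnRank_add_finrank_tailSpace (A := A) (u := u) (i.val + 1)
  rw [characters]
  omega

theorem characters_eq_finrank (i : Fin n) :
    characters A u i = Module.finrank ℂ (columnSpace A u i) := by
  rw [characters_eq, ← finrank_columnSpace_add i, Nat.add_sub_cancel]

/-- In this form Cartan's number can be compared term by term with the filtration of the
prolongation. -/
theorem sum_characters_eq :
    ∑ i : Fin n, (i.val + 1) * characters A u i =
      ∑ i ∈ Finset.range n, Module.finrank ℂ (tailSpace A u i) := by
  have h := sum_succ_mul_add_mul (k := fun i => Module.finrank ℂ (tailSpace A u i))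
    (s := fun i => Module.finrank ℂ (tailSpace A u i) - Module.finrank ℂ (tailSpace A u (i + 1)))
    (fun i => Nat.sub_add_cancel (Submodule.finrank_mono (tailSpace_antitone i.le_succ))) n
  simp only [finrank_tailSpace_self, mul_zero, add_zero] at h
  rw [← h, ← Fin.sum_univ_eq_sum_range
    (fun i => (i + 1) * (Module.finrank ℂ (tailSpace A u i) -
      Module.finrank ℂ (tailSpace A u (i + 1))))]
  exact Finset.sum_congr rfl fun i _ => by rw [characters_eq]

theorem sum_characters : ∑ i : Fin n, characters A u i = Module.finrank ℂ A := by
  have h := sum_add_of_add_succ (p := fun i => Module.finrank ℂ (tailSpace A u i))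
    (r := fun i => Module.finrank ℂ (tailSpace A u i) - Module.finrank ℂ (tailSpace A u (i + 1)))
    n (fun i _ => Nat.sub_add_cancel (Submodule.finrank_mono (tailSpace_antitone i.le_succ)))
  have h0 : tailSpace A u 0 = A := by ext π; simp [mem_tailSpace]
  simp only [finrank_tailSpace_self, add_zero] at h
  rw [h0] at h
  rw [← h, ← Fin.sum_univ_eq_sum_range
    (fun i => Module.finrank ℂ (tailSpace A u i) - Module.finrank ℂ (tailSpace A u (i + 1)))]
  exact Finset.sum_congr rfl fun i _ => by rw [characters_eq]

/-- Cartan's test: every element of the tableau with vanishing first columns is a column of an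
element of the prolongation with vanishing first columns. -/
theorem map_prolongationTail
    (hC : ∑ i : Fin n, (i.val + 1) * characters A u i = Module.finrank ℂ (prolongation A))
    (i : Fin n) :
    (prolongationTail A u i.val).map (LinearMap.applyₗ (u i)) = tailSpace A u i.val := by
  let r : ℕ → ℕ := fun i => Module.finrank ℂ (prolongationTail A u i) -
    Module.finrank ℂ (prolongationTail A u (i + 1))
  have hr : ∀ i : Fin n, r i + Module.finrank ℂ (prolongationTail A u (i.val + 1)) =
      Module.finrank ℂ (prolongationTail A u i.val) ∧ r i =
      Module.finrank ℂ ((prolongationTail A u i.val).map (LinearMap.applyₗ (u i))) := by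
    intro i
    have h := finrank_map_add_finrank_inf_ker (prolongationTail A u i.val) (LinearMap.applyₗ (u i))
    rw [← prolongationTail_succ] at h
    simp only [r]
    omega
  have hsum := sum_add_of_add_succ (p := fun i => Module.finrank ℂ (prolongationTail A u i))
    (r := r) n (fun i hi => (hr ⟨i, hi⟩).1)
  rw [finrank_prolongationTail_self, add_zero, prolongationTail_zero] at hsum
  -- Two sums of dimensions agree and are ordered termwise, so they agree termwise.
  rw [sum_characters_eq, ← hsum, Eq.comm, Finset.sum_eq_sum_iff_of_le] at hC
  · refine Submodule.eq_of_le_of_finrank_eq (map_prolongationTail_le i) ?_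
    rw [← (hr i).2, hC i.val (Finset.mem_range.2 i.isLt)]
  · intro j hj
    have := Submodule.finrank_mono (map_prolongationTail_le (A := A) (u := u)
      ⟨j, Finset.mem_range.1 hj⟩)
    rwa [← (hr ⟨j, Finset.mem_range.1 hj⟩).2] at this

/-- Every element of `A` with vanishing columns before column `i` is column `i` of a symmetric
family of such elements. -/
theorem exists_symmetric_family
    (hC : ∑ i : Fin n, (i.val + 1) * characters A u i = Module.finrank ℂ (prolongation A))
    (i : Fin n) {π : V →ₗ[ℂ] W} (hπ : π ∈ tailSpace A u i.val) :
    ∃ P : V →ₗ[ℂ] V →ₗ[ℂ] W, (∀ v, P v ∈ tailSpace A u i.val) ∧ (∀ v v', P v v' = P v' v) ∧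
      P (u i) = π := by
  rw [← map_prolongationTail hC i] at hπ
  obtain ⟨P, hP, rfl⟩ := hπ
  obtain ⟨⟨hPA, hsymm⟩, h0⟩ := mem_prolongationTail.1 hP
  refine ⟨P, fun v => mem_tailSpace.2 ⟨hPA v, fun j hj => ?_⟩, hsymm, rfl⟩
  rw [hsymm, h0 j hj, LinearMap.zero_apply]

/-- With `P (u i) = π` from Cartan's test, `π v = P (u i) v = P v (u i)` is column `i` of `P v`. -/
theorem apply_mem_columnSpace
    (hC : ∑ i : Fin n, (i.val + 1) * characters A u i = Module.finrank ℂ (prolongation A))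
    (i : Fin n) {π : V →ₗ[ℂ] W} (hπ : π ∈ tailSpace A u i.val) (v : V) :
    π v ∈ columnSpace A u i := by
  obtain ⟨P, hP, hsymm, rfl⟩ := exists_symmetric_family hC i hπ
  exact mem_columnSpace.2 ⟨P v, hP v, hsymm _ _⟩

theorem columnSpace_antitone
    (hC : ∑ i : Fin n, (i.val + 1) * characters A u i = Module.finrank ℂ (prolongation A)) :
    Antitone (columnSpace A u) := by
  rintro i j hij _ ⟨π, hπ, rfl⟩
  exact apply_mem_columnSpace hC i (tailSpace_antitone (Fin.le_def.1 hij) hπ) _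

theorem characters_antitone
    (hC : ∑ i : Fin n, (i.val + 1) * characters A u i = Module.finrank ℂ (prolongation A)) :
    Antitone (characters A u) := by
  intro i j hij
  rw [characters_eq_finrank, characters_eq_finrank]
  exact Submodule.finrank_mono (columnSpace_antitone hC hij)

/-! ### Rank one elements -/

/-- A commuting family of endomorphisms has a common eigenvector. -/
theorem exists_common_eigenvector {ι M : Type*} [AddCommGroup M] [Module ℂ M]
    [FiniteDimensional ℂ M] [Nontrivial M] (f : ι → Module.End ℂ M)
    (hf : ∀ i j x, f i (f j x) = f j (f i x)) :
    ∃ x : M, x ≠ 0 ∧ ∀ i, ∃ μ : ℂ, f i x = μ • x := by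
  -- On a minimal nonzero invariant subspace each `f i` is scalar: an eigenspace of `f i` in it is
  -- again invariant because the family commutes.
  obtain ⟨N, ⟨hN, hinv⟩, hmin⟩ := IsArtinian.set_has_minimal
    {N : Submodule ℂ M | N ≠ ⊥ ∧ ∀ i, ∀ x ∈ N, f i x ∈ N}
    ⟨⊤, top_ne_bot, fun _ _ _ => trivial⟩
  have hscalar : ∀ i, ∃ μ : ℂ, ∀ x ∈ N, f i x = μ • x := by
    intro i
    have : Nontrivial N := Submodule.nontrivial_iff_ne_bot.2 hN
    obtain ⟨μ, hμ⟩ := Module.End.exists_eigenvalue ((f i).restrict (hinv i))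
    obtain ⟨y, hy⟩ := hμ.exists_hasEigenvector
    have hN' : N ⊓ Module.End.eigenspace (f i) μ ∈
        {N : Submodule ℂ M | N ≠ ⊥ ∧ ∀ i, ∀ x ∈ N, f i x ∈ N} := by
      refine ⟨fun h => hy.2 ?_, fun j x hx => ⟨hinv j x hx.1, ?_⟩⟩
      · have : (y : M) ∈ N ⊓ Module.End.eigenspace (f i) μ :=
          ⟨y.2, Module.End.mem_eigenspace_iff.2 (congrArg Subtype.val hy.apply_eq_smul)⟩
        rw [h, Submodule.mem_bot] at this
        exact Subtype.ext this
      · have := Module.End.mem_eigenspace_iff.1 hx.2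
        rw [SetLike.mem_coe, Module.End.mem_eigenspace_iff, hf, this, map_smul]
    have hle : N ≤ N ⊓ Module.End.eigenspace (f i) μ := by
      by_contra h
      exact hmin _ hN' (lt_of_le_of_ne inf_le_left fun h' => h h'.ge)
    exact ⟨μ, fun x hx => Module.End.mem_eigenspace_iff.1 (hle hx).2⟩
  obtain ⟨x, hx, hx0⟩ := Submodule.exists_mem_ne_zero_of_ne_bot hN
  refine ⟨x, hx0, fun i => ?_⟩
  obtain ⟨μ, hμ⟩ := hscalar i
  exact ⟨μ, hμ x hx⟩

/-- A space of linear maps that is separated by evaluation at `e`, and in which every element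
belongs to a symmetric family, contains an element of rank one. -/
theorem exists_smulRight_mem {T : Submodule ℂ (V →ₗ[ℂ] W)} (hT : T ≠ ⊥) (e : V)
    (hinj : ∀ π ∈ T, π e = 0 → π = 0)
    (hP : ∀ π ∈ T, ∃ P : V →ₗ[ℂ] V →ₗ[ℂ] W,
      (∀ v, P v ∈ T) ∧ (∀ v v', P v v' = P v' v) ∧ P e = π) :
    ∃ (ξ : Module.Dual ℂ V) (w : W), w ≠ 0 ∧ ξ e = 1 ∧ ξ.smulRight w ∈ T := by
  have : Nontrivial T := Submodule.nontrivial_iff_ne_bot.2 hT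
  let ev : V → T →ₗ[ℂ] W := fun v => (LinearMap.applyₗ v).comp T.subtype
  have hev : Function.Injective (ev e) := by
    rw [injective_iff_map_eq_zero]
    exact fun π hπ => Subtype.ext (hinj π.1 π.2 hπ)
  have hmem : ∀ v (π : T), ev v π ∈ LinearMap.range (ev e) := by
    intro v π
    obtain ⟨P, hPT, hsymm, hPe⟩ := hP π.1 π.2
    refine ⟨⟨P v, hPT v⟩, ?_⟩
    change P v e = π.1 v
    rw [hsymm, hPe]
  -- `f v π` is the unique element of `T` whose value at `e` is `π v`; it exists because `P v e = P
  -- e v = π v`.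
  let f : V → Module.End ℂ T := fun v =>
    (LinearEquiv.ofInjective (ev e) hev).symm.toLinearMap.comp ((ev v).codRestrict _ (hmem v))
  have hf : ∀ v π, (f v π).1 e = π.1 v := fun v π =>
    congrArg Subtype.val
      ((LinearEquiv.ofInjective (ev e) hev).apply_symm_apply ((ev v).codRestrict _ (hmem v) π))
  have hcomm : ∀ v v' π, f v (f v' π) = f v' (f v π) := by
    intro v v' π
    obtain ⟨P, hPT, hsymm, hPe⟩ := hP π.1 π.2
    have hfP : ∀ v, f v π = ⟨P v, hPT v⟩ := by
      intro v
      apply hev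
      change (f v π).1 e = P v e
      rw [hf, hsymm, hPe]
    apply hev
    change (f v (f v' π)).1 e = (f v' (f v π)).1 e
    rw [hf, hf, hfP, hfP]
    exact hsymm _ _
  -- A common eigenvector satisfies `π v = μ_v • π e` for every `v`, so it has rank one.
  obtain ⟨π, hπ0, hπ⟩ := exists_common_eigenvector f hcomm
  have hw : π.1 e ≠ 0 := fun h => hπ0 (Subtype.ext (hinj π.1 π.2 h))
  obtain ⟨g, hg⟩ : ∃ g : Module.Dual ℂ W, g (π.1 e) = 1 := by
    obtain ⟨g, hg⟩ : ∃ g : Module.Dual ℂ W, g (π.1 e) ≠ 0 := by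
      by_contra! h
      exact hw ((Module.forall_dual_apply_eq_zero_iff ℂ _).1 h)
    exact ⟨(g (π.1 e))⁻¹ • g, by simp [hg]⟩
  have hrank : (g.comp π.1).smulRight (π.1 e) = π.1 := by
    ext v
    obtain ⟨μ, hμ⟩ := hπ v
    have h : π.1 v = μ • π.1 e := by
      rw [← hf, hμ]
      rfl
    rw [LinearMap.smulRight_apply, LinearMap.comp_apply, h, map_smul, hg, smul_eq_mul, mul_one]
  exact ⟨g.comp π.1, π.1 e, hw, hg, by rw [hrank]; exact π.2⟩

theorem tailSpace_eq_bot {k : ℕ} (hk : k ≤ n) (h0 : ∀ i : Fin n, k ≤ i.val → characters A u i = 0) :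
    tailSpace A u k = ⊥ := by
  induction hk using Nat.decreasingInduction with
  | self => exact tailSpace_self
  | of_succ k hk ih =>
    have h1 := ih fun i hi => h0 i (k.le_succ.trans hi)
    have h2 := finrank_columnSpace_add (A := A) (u := u) ⟨k, hk⟩
    rw [← characters_eq_finrank, h0 ⟨k, hk⟩ le_rfl, zero_add] at h2
    rw [← Submodule.finrank_eq_zero (R := ℂ), ← h2]
    exact Submodule.finrank_eq_zero.2 h1

/-- The tableau contains a rank one element that vanishes before the last column with a new
independent entry. -/
theorem exists_smulRight_mem_of_last
    (hC : ∑ i : Fin n, (i.val + 1) * characters A u i = Module.finrank ℂ (prolongation A))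
    (m : Fin n) (hm : 0 < characters A u m) (h0 : ∀ i, m < i → characters A u i = 0) :
    ∃ (ξ : Module.Dual ℂ V) (w : W), w ≠ 0 ∧ ξ (u m) = 1 ∧ (∀ j < m, ξ (u j) = 0) ∧
      ξ.smulRight w ∈ A := by
  -- No later column brings new entries, so an element of the `m`-th tail is determined by its value
  -- at `u m`.
  have hbot : tailSpace A u (m.val + 1) = ⊥ :=
    tailSpace_eq_bot m.isLt fun i hi => h0 i (Fin.lt_def.2 hi)
  obtain ⟨ξ, w, hw, hξ, hmem⟩ := exists_smulRight_mem (T := tailSpace A u m.val) (e := u m)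
    (fun h => by
      rw [characters_eq_finrank, columnSpace, h, Submodule.map_bot, finrank_bot] at hm
      exact hm.false)
    (fun π hπ h => by
      have : π ∈ tailSpace A u (m.val + 1) := by
        rw [tailSpace_succ]
        exact ⟨hπ, h⟩
      rwa [hbot, Submodule.mem_bot] at this)
    (fun π hπ => exists_symmetric_family hC m hπ)
  obtain ⟨hA, hj⟩ := mem_tailSpace.1 hmem
  refine ⟨ξ, w, hw, hξ, fun j hjm => ?_, hA⟩
  exact (smul_eq_zero.1 (hj j hjm)).resolve_right hw

end Tableau

end

noncomputable section

namespace Tableau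

/-! ### Perturbing a generic basis -/

/-- The rank of `τ F + N` is at least the rank of `F` for all but finitely many `τ`. -/
theorem finite_finrank_range_lt {X Y : Type*} [AddCommGroup X] [Module ℂ X]
    [AddCommGroup Y] [Module ℂ Y] [FiniteDimensional ℂ Y] (F N : X →ₗ[ℂ] Y) :
    {τ : ℂ | Module.finrank ℂ (LinearMap.range (τ • F + N)) <
      Module.finrank ℂ (LinearMap.range F)}.Finite := by
  obtain ⟨s, hs⟩ := F.rangeRestrict.exists_rightInverse_of_surjective F.range_rangeRestrict
  obtain ⟨p, hp⟩ := (LinearMap.range F).subtype.exists_leftInverse_of_injective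
    (LinearMap.range F).ker_subtype
  -- If `τ • F + N` kills `s y`, applying the retraction `p` gives `τ • y + p (N (s y)) = 0`. Thus
  -- `τ` is bad only if it is an eigenvalue of `G`.
  let G : Module.End ℂ (LinearMap.range F) := -(p.comp (N.comp s))
  refine (Module.End.finite_hasEigenvalue G).subset fun τ hτ => ?_
  rw [Set.mem_ofPred_eq] at hτ ⊢
  by_contra hG
  refine not_le.2 hτ (LinearMap.finrank_le_finrank_of_injective
    (f := (τ • F + N).rangeRestrict.comp s) ?_)
  rw [injective_iff_map_eq_zero]
  intro y hy
  have h1 : τ • F (s y) + N (s y) = 0 := congrArg Subtype.val hy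
  have h2 : F (s y) = (y : Y) := congrArg Subtype.val (LinearMap.congr_fun hs y)
  have h3 : p (y : Y) = y := LinearMap.congr_fun hp y
  have h4 : τ • y + p (N (s y)) = 0 := by
    have := congrArg p h1
    rwa [map_add, map_smul, h2, h3, map_zero] at this
  by_contra hy0
  refine hG (Module.End.hasEigenvalue_of_hasEigenvector (x := y)
    ⟨Module.End.mem_eigenspace_iff.2 ?_, hy0⟩)
  change -p (N (s y)) = τ • y
  rw [neg_eq_iff_eq_neg, eq_neg_iff_add_eq_zero, add_comm, h4]

variable {V : Type*} {W : Type*} [AddCommGroup V] [Module ℂ V] [AddCommGroup W] [Module ℂ W]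
  {A : Submodule ℂ (V →ₗ[ℂ] W)} {n r : ℕ} {u : Module.Basis (Fin n) ℂ V}
  [FiniteDimensional ℂ V] [FiniteDimensional ℂ W]

theorem columnRank_zero (u : Module.Basis (Fin n) ℂ V) : columnRank A u 0 = 0 := by
  have h := columnRank_add_finrank_tailSpace (A := A) (u := u) 0
  have h0 : tailSpace A u 0 = A := by ext π; simp [mem_tailSpace]
  rw [h0] at h
  omega

/-- Column ranks increase with the number of columns, so the truncated subtraction in `characters`
is an honest one. -/
theorem columnRank_succ (u : Module.Basis (Fin n) ℂ V) (i : Fin n) :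
    columnRank A u (i.val + 1) = columnRank A u i.val + characters A u i := by
  have h1 := columnRank_add_finrank_tailSpace (A := A) (u := u) i.val
  have h2 := columnRank_add_finrank_tailSpace (A := A) (u := u) (i.val + 1)
  have h3 := Submodule.finrank_mono (tailSpace_antitone (A := A) (u := u) (Nat.le_add_right i.val 1))
  rw [characters]
  omega

/-- A basis whose column ranks are at least those of a generic basis has the same characters. -/
theorem characters_eq_of_columnRank_le (hu : IsGenericBasis A u) {u' : Module.Basis (Fin n) ℂ V}
    (h : ∀ k, columnRank A u k ≤ columnRank A u' k) : characters A u' = characters A u := by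
  refine toLex.injective (le_antisymm (hu u') ?_)
  by_contra hlt
  obtain ⟨i, hi, hi'⟩ := not_le.1 hlt
  -- Up to the first index `i` where the characters differ the ranks agree; a smaller character at
  -- `i` would then give a smaller rank at `i + 1`.
  have hk : ∀ k : ℕ, k ≤ i.val → columnRank A u' k = columnRank A u k := by
    intro k
    induction k with
    | zero => intro _; rw [columnRank_zero, columnRank_zero]
    | succ k ih =>
      intro hki
      have hkn : k < n := by omega
      have h1 : characters A u' ⟨k, hkn⟩ = characters A u ⟨k, hkn⟩ := hi ⟨k, hkn⟩ hki
      rw [columnRank_succ u' ⟨k, hkn⟩, columnRank_succ u ⟨k, hkn⟩, ih (by omega), h1]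
  have h1 := h (i.val + 1)
  rw [columnRank_succ, columnRank_succ, hk i.val le_rfl] at h1
  have h2 : characters A u' i < characters A u i := hi'
  omega

/-- A generic basis stays generic under all but finitely many members of a one-parameter family of
transvections. -/
theorem exists_finite_characters_transvection (hu : IsGenericBasis A u) (v : V)
    (γ : Module.Dual ℂ V) :
    ∃ S : Set ℂ, S.Finite ∧ ∀ τ ∉ S, τ ≠ 0 ∧ ∀ h : (τ⁻¹ • γ) v = 0,
      characters A (u.map (LinearEquiv.transvection h)) = characters A u := by
  -- The transvected columns are `π (u i) + τ⁻¹ γ(u i) π v`. Multiplied by `τ` they form the pencil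
  -- `τ • F + N` with `N` independent of `τ`.
  let N : ∀ k, A →ₗ[ℂ] ({i : Fin n // i.val < k} → W) := fun k =>
    LinearMap.pi fun i => γ (u i.1) • (LinearMap.applyₗ v).comp A.subtype
  refine ⟨{0} ∪ ⋃ k ∈ Finset.range (n + 1),
    {τ : ℂ | Module.finrank ℂ (LinearMap.range (τ • firstColumns A u k + N k)) <
      Module.finrank ℂ (LinearMap.range (firstColumns A u k))},
    (Set.finite_singleton _).union ((Finset.range (n + 1)).finite_toSet.biUnion fun k _ =>
      finite_finrank_range_lt _ _), fun τ hτ => ?_⟩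
  rw [Set.mem_union, not_or, Set.mem_singleton_iff] at hτ
  refine ⟨hτ.1, fun h => characters_eq_of_columnRank_le hu ?_⟩
  have hcol : ∀ k, τ • firstColumns A u k + N k =
      τ • firstColumns A (u.map (LinearEquiv.transvection h)) k := by
    intro k
    ext π i
    simp [firstColumns, N, LinearMap.transvection.apply, smul_smul, hτ.1]
  have hle : ∀ k ≤ n, columnRank A u k ≤
      columnRank A (u.map (LinearEquiv.transvection h)) k := by
    intro k hk
    by_contra hlt
    refine hτ.2 (Set.mem_biUnion (Finset.mem_coe.2 (Finset.mem_range.2 (Nat.lt_succ_of_le hk))) ?_)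
    rw [Set.mem_ofPred_eq, hcol, LinearMap.range_smul _ _ hτ.1]
    exact not_le.1 hlt
  intro k
  rcases le_total k n with hk | hk
  · exact hle k hk
  -- Beyond `n` columns both ranks are `dim A`.
  · have htail : ∀ u : Module.Basis (Fin n) ℂ V, tailSpace A u k = ⊥ := fun u =>
      eq_bot_iff.2 ((tailSpace_antitone hk).trans tailSpace_self.le)
    have h1 := columnRank_add_finrank_tailSpace (A := A) (u := u) k
    have h2 := columnRank_add_finrank_tailSpace (A := A)
      (u := u.map (LinearEquiv.transvection h)) k
    rw [htail, finrank_bot] at h1 h2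
    omega

/-- Over all but finitely many points of a line of covectors in direction `u^m`, where `u_m` is the
last column with a new independent entry, there is a rank one element. -/
theorem exists_finite_smulRight_mem (hu : IsGenericBasis A u)
    (hC : ∑ i : Fin n, (i.val + 1) * characters A u i = Module.finrank ℂ (prolongation A))
    (m : Fin n) (hm : 0 < characters A u m) (h0 : ∀ i, m < i → characters A u i = 0)
    (φ : Module.Dual ℂ V) :
    ∃ S : Set ℂ, S.Finite ∧ ∀ τ ∉ S, ∃ (ξ : Module.Dual ℂ V) (w : W), w ≠ 0 ∧ ξ (u m) = τ ∧
      (∀ j < m, ξ (u j) = φ (u j)) ∧ ξ.smulRight w ∈ A := by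
  -- The transvected basis has `u' j = u j - τ⁻¹ φ(u j) u m` for `j < m`. A covector that is zero on
  -- these and one at `u m` becomes, after scaling by `τ`, equal to `φ` before `m` and `τ` at `m`.
  let γ : Module.Dual ℂ V := u.constr ℂ fun j => if j < m then -φ (u j) else 0
  have hγu : ∀ j, γ (u j) = if j < m then -φ (u j) else 0 := fun j => u.constr_basis ℂ _ j
  have hγ : γ (u m) = 0 := by rw [hγu, if_neg (lt_irrefl m)]
  obtain ⟨S, hS, hS'⟩ := exists_finite_characters_transvection hu (u m) γ
  refine ⟨S, hS, fun τ hτ => ?_⟩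
  obtain ⟨hτ0, hchar⟩ := hS' τ hτ
  have h : (τ⁻¹ • γ) (u m) = 0 := by simp [hγ]
  specialize hchar h
  set u' := u.map (LinearEquiv.transvection h)
  have hu' : ∀ j, u' j = u j + (τ⁻¹ * γ (u j)) • u m := fun j => by
    simp [u', LinearMap.transvection.apply]
  obtain ⟨ξ, w, hw, hξm, hξ, hA⟩ := exists_smulRight_mem_of_last (u := u') (A := A)
    (by rw [hchar, hC]) m (by rw [hchar]; exact hm) (by rw [hchar]; exact h0)
  have hξm' : ξ (u m) = 1 := by rw [← hξm, hu', hγ]; simp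
  refine ⟨τ • ξ, w, hw, by simp [hξm'], fun j hj => ?_, ?_⟩
  · have h1 := hξ j hj
    rw [hu', hγu, if_pos hj, map_add, map_smul, hξm', smul_eq_mul, mul_one] at h1
    rw [LinearMap.smul_apply, smul_eq_mul, eq_neg_of_add_eq_zero_left h1]
    field_simp
  · have : (τ • ξ).smulRight w = τ • ξ.smulRight w := by
      ext v
      simp [mul_smul]
    rw [this]
    exact A.smul_mem _ hA

/-! ### Rank one elements and the symbol endomorphisms -/

section GenericPair

variable {z : Module.Basis (Fin r) ℂ W}

omit [FiniteDimensional ℂ V] [FiniteDimensional ℂ W]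

theorem upperLeft_fill (h : IsGenericPair A u z) (φ : Module.Dual ℂ V) (w : W) :
    upperLeft A u z (fill h φ w) = fun p => φ (u p.1.1) * z.coord p.1.2 w :=
  (LinearEquiv.ofBijective (upperLeft A u z) h.bijective).apply_symm_apply _

/-- The upper-left entries are coordinates on `A`, and a column with zero character has none of
them. Agreement of `φ` and `ξ` on the other columns is therefore enough. -/
theorem fill_eq (h : IsGenericPair A u z) {φ ξ : Module.Dual ℂ V} {w : W}
    (hA : ξ.smulRight w ∈ A) (hφ : ∀ i, 0 < characters A u i → φ (u i) = ξ (u i)) :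
    fill h φ w = ⟨ξ.smulRight w, hA⟩ := by
  apply h.bijective.1
  rw [upperLeft_fill]
  funext p
  rw [hφ p.1.1 (by have := p.2; omega)]
  simp [upperLeft]

/-- This link turns rank one elements into common eigenvectors of the symbol endomorphisms. -/
theorem symbolEnd_eq_smul (h : IsGenericPair A u z) {φ ξ : Module.Dual ℂ V} {w : W}
    (hA : ξ.smulRight w ∈ A) (hφ : ∀ i, 0 < characters A u i → φ (u i) = ξ (u i)) (v : V) :
    symbolEnd h φ v w = ξ v • w := by
  change (fill h φ w).1 v = _
  rw [fill_eq h hA hφ]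
  rfl

theorem fill_add_smul (h : IsGenericPair A u z) (φ ψ : Module.Dual ℂ V) (c : ℂ) (w : W) :
    fill h (φ + c • ψ) w = fill h φ w + c • fill h ψ w := by
  apply h.bijective.1
  rw [map_add, map_smul, upperLeft_fill, upperLeft_fill, upperLeft_fill]
  funext p
  simp only [LinearMap.add_apply, LinearMap.smul_apply, Pi.add_apply, Pi.smul_apply, smul_eq_mul]
  ring

theorem symbolEnd_add_smul (h : IsGenericPair A u z) (φ ψ : Module.Dual ℂ V) (c : ℂ) (v : V)
    (w : W) : symbolEnd h (φ + c • ψ) v w = symbolEnd h φ v w + c • symbolEnd h ψ v w := by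
  change (fill h (φ + c • ψ) w).1 v = _
  rw [fill_add_smul]
  rfl

end GenericPair

/-- If a family of pencils of endomorphisms `P_i + τ Q_i` has common eigenvectors, with eigenvalues
`α_j + τ β_j` for some of the indices, for all but finitely many `τ`, then it does so for all. -/
theorem exists_common_eigenvector_of_finite {ι κ : Type*} (P Q : ι → Module.End ℂ (Fin r → ℂ))
    (k : κ → ι) (α β : κ → ℂ) {S : Set ℂ} (hS : S.Finite)
    (h : ∀ τ ∉ S, ∃ x : Fin r → ℂ, x ≠ 0 ∧ (∀ i, ∃ c : ℂ, P i x + τ • Q i x = c • x) ∧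
      ∀ j, P (k j) x + τ • Q (k j) x = (α j + τ * β j) • x) (τ : ℂ) :
    ∃ x : Fin r → ℂ, x ≠ 0 ∧
      (∀ i a b, x a * (P i x + τ • Q i x) b = x b * (P i x + τ • Q i x) a) ∧
      ∀ j, P (k j) x + τ • Q (k j) x = (α j + τ * β j) • x := by
  -- Being an eigenvector is expressed by vanishing two-by-two minors, a closed condition that needs
  -- no control of the eigenvalue. The sphere is compact, so the projection of `C` to the parameter
  -- line is closed.
  let C : Set (ℂ × Metric.sphere (0 : Fin r → ℂ) 1) := {p |
    (∀ i a b, p.2.1 a * (P i p.2.1 + p.1 • Q i p.2.1) b =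
      p.2.1 b * (P i p.2.1 + p.1 • Q i p.2.1) a) ∧
    ∀ j, P (k j) p.2.1 + p.1 • Q (k j) p.2.1 = (α j + p.1 * β j) • p.2.1}
  have hP : ∀ i, Continuous (P i) := fun i => (P i).continuous_of_finiteDimensional
  have hQ : ∀ i, Continuous (Q i) := fun i => (Q i).continuous_of_finiteDimensional
  have hx : Continuous fun p : ℂ × Metric.sphere (0 : Fin r → ℂ) 1 => p.2.1 :=
    continuous_subtype_val.comp continuous_snd
  have hB : ∀ i, Continuous fun p : ℂ × Metric.sphere (0 : Fin r → ℂ) 1 =>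
      P i p.2.1 + p.1 • Q i p.2.1 := fun i =>
    ((hP i).comp hx).add (continuous_fst.smul ((hQ i).comp hx))
  have hC : IsClosed C := by
    simp only [C, Set.ofPred_and, Set.ofPred_forall]
    refine IsClosed.inter ?_ ?_
    · refine isClosed_iInter fun i => isClosed_iInter fun a => isClosed_iInter fun b => ?_
      exact isClosed_eq (((continuous_apply a).comp hx).mul ((continuous_apply b).comp (hB i)))
        (((continuous_apply b).comp hx).mul ((continuous_apply a).comp (hB i)))
    · refine isClosed_iInter fun j => isClosed_eq (hB _) ?_
      exact (continuous_const.add (continuous_fst.mul continuous_const)).smul hx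
  have hD : IsClosed (Prod.fst '' C) := isClosedMap_fst_of_compactSpace C hC
  have hSD : Sᶜ ⊆ Prod.fst '' C := by
    intro τ hτ
    obtain ⟨x, hx0, hx1, hx2⟩ := h τ hτ
    have hnorm : ‖x‖ ≠ 0 := norm_ne_zero_iff.2 hx0
    have hB' : ∀ i, P i (((‖x‖ : ℂ)⁻¹) • x) + τ • Q i (((‖x‖ : ℂ)⁻¹) • x) =
        ((‖x‖ : ℂ)⁻¹) • (P i x + τ • Q i x) := by
      intro i
      rw [map_smul, map_smul, smul_add, smul_comm τ]
    refine ⟨(τ, ⟨((‖x‖ : ℂ)⁻¹) • x, ?_⟩), ⟨fun i a b => ?_, fun j => ?_⟩, rfl⟩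
    · rw [mem_sphere_zero_iff_norm, norm_smul, norm_inv, Complex.norm_real, norm_norm,
        inv_mul_cancel₀ hnorm]
    · obtain ⟨c, hc⟩ := hx1 i
      simp only [hB', hc, Pi.smul_apply, smul_eq_mul]
      ring
    · simp only [hB', hx2]
      rw [smul_comm]
  have hdense : Dense Sᶜ := hS.countable.dense_compl ℝ
  have huniv : Prod.fst '' C = Set.univ :=
    Set.eq_univ_of_univ_subset (hdense.closure_eq ▸ hD.closure_subset_iff.2 hSD)
  obtain ⟨⟨τ', x⟩, hxC, rfl⟩ : τ ∈ Prod.fst '' C := huniv ▸ Set.mem_univ τ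
  refine ⟨x.1, fun h0 => ?_, hxC.1, hxC.2⟩
  have := x.2
  rw [h0, mem_sphere_zero_iff_norm, norm_zero] at this
  exact zero_ne_one this

/-- Every covector on `U` extends to a covector `ξ` such that the tableau contains an element
`w ⊗ ξ` of rank one. -/
theorem exists_smulRight_mem_over {z : Module.Basis (Fin r) ℂ W} (h : IsGenericPair A u z)
    (hC : ∑ i : Fin n, (i.val + 1) * characters A u i = Module.finrank ℂ (prolongation A))
    (m : Fin n) (hm : 0 < characters A u m) (h0 : ∀ i, m < i → characters A u i = 0)
    (φ : Module.Dual ℂ V) :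
    ∃ (ξ : Module.Dual ℂ V) (w : W), w ≠ 0 ∧ (∀ j ≤ m, ξ (u j) = φ (u j)) ∧
      ξ.smulRight w ∈ A := by
  obtain ⟨S, hS, hS'⟩ := exists_finite_smulRight_mem h.generic hC m hm h0 φ
  let e := z.equivFun
  let φ₀ : Module.Dual ℂ V := φ + (-φ (u m)) • u.coord m
  let conj : Module.End ℂ W → Module.End ℂ (Fin r → ℂ) := fun f =>
    e.toLinearMap.comp (f.comp e.symm.toLinearMap)
  have hconj : ∀ (v : V) (τ : ℂ) (x : Fin r → ℂ),
      conj (symbolEnd h φ₀ v) x + τ • conj (symbolEnd h (u.coord m) v) x =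
        e (symbolEnd h (φ₀ + τ • u.coord m) v (e.symm x)) := by
    intro v τ x
    rw [symbolEnd_add_smul, map_add, map_smul]
    rfl
  have hval : ∀ (τ : ℂ) (j : Fin n), (φ₀ + τ • u.coord m) (u j) =
      φ₀ (u j) + τ * (u.coord m (u j)) := fun τ j => rfl
  have hφm : ∀ τ : ℂ, (φ₀ + τ • u.coord m) (u m) = τ := by
    intro τ
    simp [φ₀]
  have hφj : ∀ (τ : ℂ) (j : Fin n), j ≠ m → (φ₀ + τ • u.coord m) (u j) = φ (u j) := by
    intro τ j hj
    simp [φ₀, hj]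
  obtain ⟨x, hx0, hx1, hx2⟩ := exists_common_eigenvector_of_finite
    (fun i => conj (symbolEnd h φ₀ (u i))) (fun i => conj (symbolEnd h (u.coord m) (u i)))
    (fun j : {j : Fin n // j ≤ m} => j.1) (fun j => φ₀ (u j.1)) (fun j => u.coord m (u j.1)) hS
    (fun τ hτ => by
      obtain ⟨ξ, w, hw, hξm, hξj, hA⟩ := hS' τ hτ
      have hle : ∀ j ≤ m, (φ₀ + τ • u.coord m) (u j) = ξ (u j) := by
        intro j hj
        rcases eq_or_lt_of_le hj with rfl | hj
        · rw [hφm, hξm]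
        · rw [hφj τ j hj.ne, hξj j hj]
      have hB := symbolEnd_eq_smul h hA (φ := φ₀ + τ • u.coord m) fun i hi =>
        hle i (not_lt.1 fun hmi => hi.ne' (h0 i hmi))
      refine ⟨e w, fun he => hw (e.map_eq_zero_iff.1 he), fun i => ⟨ξ (u i), ?_⟩, fun j => ?_⟩
      · rw [hconj, e.symm_apply_apply, hB, map_smul]
      · rw [hconj, e.symm_apply_apply, hB, map_smul, ← hle _ j.2, hval])
    (φ (u m))
  have hφ : φ₀ + φ (u m) • u.coord m = φ := by
    simp [φ₀]
  simp only [hconj, hφ] at hx1 hx2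
  obtain ⟨a, ha⟩ : ∃ a, x a ≠ 0 := by
    by_contra! h
    exact hx0 (funext h)
  set w := e.symm x
  have hw : w ≠ 0 := fun hw => hx0 (e.symm.map_eq_zero_iff.1 hw)
  -- Since every column of `fill h φ w` is proportional to `w`, the covector can be read off from
  -- row `a`, where `w` has a nonzero coordinate.
  let ξ : Module.Dual ℂ V := (x a)⁻¹ • (z.coord a).comp (fill h φ w).1
  have hξ : ∀ i, ξ (u i) = (x a)⁻¹ * e (symbolEnd h φ (u i) w) a := fun i => rfl
  refine ⟨ξ, w, hw, fun j hj => ?_, ?_⟩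
  · rw [hξ, hx2 ⟨j, hj⟩, ← hval, hφ, Pi.smul_apply, smul_eq_mul, mul_comm, mul_assoc,
      mul_inv_cancel₀ ha, mul_one]
  · have : ξ.smulRight w = (fill h φ w).1 := by
      refine u.ext fun i => e.injective (funext fun b => ?_)
      change e (ξ (u i) • w) b = e (symbolEnd h φ (u i) w) b
      rw [map_smul, e.apply_symm_apply, Pi.smul_apply, smul_eq_mul, hξ, mul_assoc,
        mul_comm _ (x b), ← hx1 i a b, inv_mul_cancel_left₀ ha]
    rw [this]
    exact (fill h φ w).2

end Tableau

end

noncomputable section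

namespace Tableau

/-! ### Endovolutive bases -/

/-- Greedy choice: the `a` vectors already chosen span too little to contain `G a`. -/
theorem exists_linearIndependent_mem {W : Type*} [AddCommGroup W] [Module ℂ W]
    [FiniteDimensional ℂ W] {r : ℕ} (G : Fin r → Submodule ℂ W)
    (hG : ∀ a, a.val < Module.finrank ℂ (G a)) :
    ∃ z : Fin r → W, LinearIndependent ℂ z ∧ ∀ a, z a ∈ G a := by
  induction r with
  | zero => exact ⟨Fin.elim0, linearIndependent_empty_type, fun a => a.elim0⟩
  | succ r ih =>
    obtain ⟨z, hz, hzG⟩ := ih (fun a => G a.castSucc) fun a => hG a.castSucc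
    obtain ⟨x, hxG, hx⟩ : ∃ x ∈ G (Fin.last r), x ∉ Submodule.span ℂ (Set.range z) := by
      by_contra! h
      have h1 : Module.finrank ℂ (G (Fin.last r)) ≤
          Module.finrank ℂ (Submodule.span ℂ (Set.range z)) := Submodule.finrank_mono h
      rw [finrank_span_eq_card hz, Fintype.card_fin] at h1
      exact not_lt.2 h1 (hG (Fin.last r))
    refine ⟨Fin.snoc z x, linearIndependent_finSnoc.2 ⟨hz, hx⟩, fun a => ?_⟩
    refine Fin.lastCases ?_ (fun a => ?_) a
    · rw [Fin.snoc_last]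
      exact hxG
    · rw [Fin.snoc_castSucc]
      exact hzG a

theorem mem_initialSpan {W : Type*} [AddCommGroup W] [Module ℂ W] {r : ℕ}
    {z : Module.Basis (Fin r) ℂ W} {k : ℕ} {w : W} :
    w ∈ initialSpan z k ↔ ∀ a : Fin r, k ≤ a.val → z.coord a w = 0 := by
  rw [initialSpan, Module.Basis.mem_span_image]
  refine ⟨fun h a ha => ?_, fun h a ha => ?_⟩
  · by_contra h0
    exact not_lt.2 ha (h (Finset.mem_coe.2 (Finsupp.mem_support_iff.2 h0)))
  · by_contra h0
    exact Finsupp.mem_support_iff.1 (Finset.mem_coe.1 ha) (h a (not_lt.1 h0))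

theorem finrank_initialSpan {W : Type*} [AddCommGroup W] [Module ℂ W] {r : ℕ}
    (z : Module.Basis (Fin r) ℂ W) {k : ℕ} (hk : k ≤ r) :
    Module.finrank ℂ (initialSpan z k) = k := by
  have h : initialSpan z k = Submodule.span ℂ (Set.range (z ∘ Fin.castLE hk)) := by
    rw [initialSpan, Set.range_comp, Fin.range_castLE]
  rw [h, finrank_span_eq_card (z.linearIndependent.comp _ (Fin.castLE_injective hk)),
    Fintype.card_fin]

theorem initialSpan_mono {W : Type*} [AddCommGroup W] [Module ℂ W] {r : ℕ}
    (z : Module.Basis (Fin r) ℂ W) : Monotone (initialSpan z) := fun _ _ hkl _ hw =>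
  mem_initialSpan.2 fun a ha => mem_initialSpan.1 hw a (hkl.trans ha)

variable {V : Type*} {W : Type*} [AddCommGroup V] [Module ℂ V] [AddCommGroup W] [Module ℂ W]
  {A : Submodule ℂ (V →ₗ[ℂ] W)} {n r : ℕ} {u : Module.Basis (Fin n) ℂ V}
  {z : Module.Basis (Fin r) ℂ W} [FiniteDimensional ℂ V] [FiniteDimensional ℂ W]

theorem characters_le_finrank (i : Fin n) : characters A u i ≤ Module.finrank ℂ W := by
  rw [characters_eq_finrank]
  exact Submodule.finrank_le _

/-- There is a basis of `W` adapted to the decreasing family of the column spaces. -/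
theorem exists_initialSpan_eq_columnSpace
    (hC : ∑ i : Fin n, (i.val + 1) * characters A u i = Module.finrank ℂ (prolongation A)) :
    ∃ z : Module.Basis (Fin (Module.finrank ℂ W)) ℂ W,
      ∀ i, initialSpan z (characters A u i) = columnSpace A u i := by
  obtain ⟨z, hz, hzG⟩ := exists_linearIndependent_mem (r := Module.finrank ℂ W)
    -- The column spaces are nested, so this intersection is the one at the last `i` with `a < s_i`,
    -- of dimension `s_i > a`. If there is no such `i`, it is all of `W`.
    (fun a => ⨅ (i : Fin n) (_ : a.val < characters A u i), columnSpace A u i) (by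
      intro a
      by_cases h : ∃ i, a.val < characters A u i
      · obtain ⟨i, hi, hmax⟩ := (Set.toFinite {i | a.val < characters A u i}).exists_maximal h
        refine lt_of_lt_of_le (lt_of_lt_of_eq hi (characters_eq_finrank i))
          (Submodule.finrank_mono (le_iInf₂ fun j hj => columnSpace_antitone hC ?_))
        rcases le_total j i with h' | h'
        · exact h'
        · exact hmax hj h'
      · push Not at h
        have : (⨅ (i : Fin n) (_ : a.val < characters A u i), columnSpace A u i) = ⊤ :=
          iInf₂_eq_top.2 fun i hi => absurd hi (not_lt.2 (h i))
        rw [this, finrank_top]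
        exact a.isLt)
  let b := basisOfLinearIndependentOfCardEqFinrank' z hz (Fintype.card_fin _)
  have hb : ∀ a, b a = z a := fun a => by simp [b]
  refine ⟨b, fun i => Submodule.eq_of_le_of_finrank_eq ?_ ?_⟩
  · refine Submodule.span_le.2 ?_
    rintro _ ⟨a, ha, rfl⟩
    rw [hb]
    exact Submodule.mem_iInf _ |>.1 (Submodule.mem_iInf _ |>.1 (hzG a) i) ha
  · rw [finrank_initialSpan b (characters_le_finrank i), characters_eq_finrank]

omit [FiniteDimensional ℂ V] [FiniteDimensional ℂ W] in
/-- An element of the tableau whose upper-left entries vanish in the first `k` columns has vanishing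
first `k` columns, if the basis of `W` is adapted to the column spaces. -/
theorem mem_tailSpace_of_entries
    (hz : ∀ i, initialSpan z (characters A u i) = columnSpace A u i) {π : V →ₗ[ℂ] W} (hπ : π ∈ A)
    {k : ℕ} (hk : k ≤ n)
    (h0 : ∀ (i : Fin n) (a : Fin r), i.val < k → a.val < characters A u i →
      z.coord a (π (u i)) = 0) : π ∈ tailSpace A u k := by
  induction k with
  | zero => exact mem_tailSpace.2 ⟨hπ, fun i hi => absurd hi i.val.not_lt_zero⟩
  | succ k ih =>
    have hmem := ih (Nat.le_of_succ_le hk) fun i a hi => h0 i a (hi.trans k.lt_succ_self)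
    let i : Fin n := ⟨k, hk⟩
    -- Once the earlier columns vanish, this column lies in the span of the first `s_i` basis
    -- vectors, so its lower entries vanish automatically.
    have hcol : π (u i) ∈ initialSpan z (characters A u i) := by
      rw [hz]
      exact mem_columnSpace.2 ⟨π, hmem, rfl⟩
    refine (tailSpace_succ (A := A) (u := u) i).ge ⟨hmem, ?_⟩
    refine z.ext_elem fun a => ?_
    rw [map_zero, Finsupp.zero_apply]
    rcases lt_or_ge a.val (characters A u i) with ha | ha
    · exact h0 i a k.lt_succ_self ha
    · exact mem_initialSpan.1 hcol a ha

/-- Injectivity comes from clearing the columns one after another; both sides have dimension `∑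
s_i`. -/
theorem upperLeft_bijective (hz : ∀ i, initialSpan z (characters A u i) = columnSpace A u i)
    (hr : ∀ i, characters A u i ≤ r) : Function.Bijective (upperLeft A u z) := by
  have hinj : Function.Injective (upperLeft A u z) := by
    rw [injective_iff_map_eq_zero]
    intro π hπ
    have h := mem_tailSpace_of_entries (A := A) hz π.2 (k := n) le_rfl
      fun i a _ ha => congrFun hπ ⟨(i, a), ha⟩
    rw [tailSpace_self, Submodule.mem_bot] at h
    exact Subtype.ext h
  refine ⟨hinj, (LinearMap.injective_iff_surjective_of_finrank_eq_finrank ?_).1 hinj⟩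
  rw [Module.finrank_fintype_fun_eq_card, ← sum_characters (A := A) (u := u)]
  let e : {p : Fin n × Fin r // p.2.val < characters A u p.1} ≃
      Σ i : Fin n, Fin (characters A u i) :=
    { toFun := fun p => ⟨p.1.1, ⟨p.1.2.val, p.2⟩⟩
      invFun := fun q => ⟨(q.1, Fin.castLE (hr q.1) q.2), q.2.isLt⟩
      left_inv := fun _ => rfl
      right_inv := fun _ => rfl }
  rw [Fintype.card_congr e, Fintype.card_sigma]
  simp only [Fintype.card_fin]

/-- The element filled from `u^l` has no upper-left entries before column `l`, so it lies in the
`l`-th tail, and all its values lie in column space `l`. -/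
theorem isEndovolutive_of_initialSpan_eq
    (hC : ∑ i : Fin n, (i.val + 1) * characters A u i = Module.finrank ℂ (prolongation A))
    (hz : ∀ i, initialSpan z (characters A u i) = columnSpace A u i) (h : IsGenericPair A u z) :
    IsEndovolutive h := by
  intro l i w
  rw [hz]
  refine apply_mem_columnSpace hC l (mem_tailSpace_of_entries hz (fill h (u.coord l) w).2
    l.isLt.le fun j a hj ha => ?_) (u i)
  have h1 := congrFun (upperLeft_fill h (u.coord l) w) ⟨(j, a), ha⟩
  have h2 : u.coord l (u j) = 0 := by
    rw [Module.Basis.coord_apply, Module.Basis.repr_self, Finsupp.single_eq_of_ne]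
    exact (Fin.ne_of_lt hj).symm
  simp only [h2, zero_mul] at h1
  exact h1

omit [FiniteDimensional ℂ V] [FiniteDimensional ℂ W] in
/-- Cartan's test holds in every generic basis of an involutive tableau. -/
theorem IsInvolutive.cartan_test (hA : IsInvolutive A) (hu : IsGenericBasis A u) :
    ∑ i : Fin n, (i.val + 1) * characters A u i = Module.finrank ℂ (prolongation A) := by
  obtain ⟨n', u', hu', h⟩ := hA
  obtain rfl : n = n' := by
    rw [← Fintype.card_fin n, ← Fintype.card_fin n', ← Module.finrank_eq_card_basis u,
      ← Module.finrank_eq_card_basis u']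
  rw [← h, toLex.injective (le_antisymm (hu u') (hu' u))]

theorem exists_endovolutive (hA : IsInvolutive A) (hu : IsGenericBasis A u) :
    ∃ (z : Module.Basis (Fin (Module.finrank ℂ W)) ℂ W) (h : IsGenericPair A u z),
      IsEndovolutive h := by
  obtain ⟨z, hz⟩ := exists_initialSpan_eq_columnSpace (hA.cartan_test hu)
  exact ⟨z, ⟨hu, upperLeft_bijective hz characters_le_finrank⟩,
    isEndovolutive_of_initialSpan_eq (hA.cartan_test hu) hz _⟩

/-! ### The last column with a new independent entry -/

section LastColumn

omit [FiniteDimensional ℂ V] [FiniteDimensional ℂ W]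

theorem lt_lastColumn_of_pos {i : Fin n} (hi : 0 < characters A u i) : i.val < lastColumn A u :=
  Finset.le_sup (f := fun i : Fin n => i.val + 1) (Finset.mem_filter.2 ⟨Finset.mem_univ i, hi⟩)

theorem lastColumn_le : lastColumn A u ≤ n := Finset.sup_le fun i _ => i.isLt

theorem exists_last (h : 0 < lastColumn A u) : ∃ m : Fin n, m.val + 1 = lastColumn A u ∧
    0 < characters A u m ∧ ∀ i, m < i → characters A u i = 0 := by
  obtain ⟨m, hm, hmax⟩ := Finset.exists_mem_eq_sup
    (Finset.univ.filter fun i : Fin n => 0 < characters A u i) (by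
      by_contra h0
      rw [Finset.not_nonempty_iff_eq_empty] at h0
      rw [lastColumn, h0, Finset.sup_empty] at h
      exact h.false) fun i => i.val + 1
  refine ⟨m, hmax.symm, (Finset.mem_filter.1 hm).2, fun i hi => ?_⟩
  by_contra h0
  have h1 := lt_lastColumn_of_pos (A := A) (Nat.pos_of_ne_zero h0)
  have h2 : lastColumn A u = m.val + 1 := hmax
  have h3 := Fin.lt_def.1 hi
  omega

theorem mem_yPerp {φ : Module.Dual ℂ V} :
    φ ∈ yPerp A u ↔ ∀ i : Fin n, lastColumn A u ≤ i.val → φ (u i) = 0 := by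
  rw [Submodule.mem_dualAnnihilator]
  constructor
  · exact fun h i hi => h _ (Submodule.subset_span ⟨i, hi, rfl⟩)
  · intro h v hv
    have : ySpace A u ≤ LinearMap.ker φ := by
      refine Submodule.span_le.2 ?_
      rintro _ ⟨i, hi, rfl⟩
      exact h i hi
    exact this hv

theorem lastColumn_pos {φ : Module.Dual ℂ V} (hφ : φ ∈ yPerp A u) (h0 : φ ≠ 0) :
    0 < lastColumn A u := by
  by_contra h
  exact h0 (u.ext fun i => by
    rw [mem_yPerp.1 hφ i (by omega), LinearMap.zero_apply])

theorem dualProj_apply (ξ : Module.Dual ℂ V) (i : Fin n) :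
    (dualProj A u ξ).1 (u i) = if i.val < lastColumn A u then ξ (u i) else 0 := by
  change ξ (uProj A u (u i)) = _
  rw [uProj, Module.Basis.constr_basis]
  split_ifs
  · rfl
  · exact map_zero ξ

theorem dualProj_eq {φ : Module.Dual ℂ V} (hφ : φ ∈ yPerp A u) {ξ : Module.Dual ℂ V}
    (h : ∀ i : Fin n, i.val < lastColumn A u → ξ (u i) = φ (u i)) :
    dualProj A u ξ = ⟨φ, hφ⟩ := by
  refine Subtype.ext (u.ext fun i => ?_)
  rw [dualProj_apply]
  split_ifs with hi
  · exact h i hi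
  · exact (mem_yPerp.1 hφ i (not_lt.1 hi)).symm

end LastColumn

omit [FiniteDimensional ℂ W] in
theorem finrank_yPerp : Module.finrank ℂ (yPerp A u) = lastColumn A u := by
  have h1 := Subspace.finrank_add_finrank_dualAnnihilator_eq (ySpace A u)
  have h2 : Module.finrank ℂ (ySpace A u) = n - lastColumn A u := by
    have hspan : ySpace A u = Submodule.span ℂ
        (Set.range (u ∘ fun i : {i : Fin n // lastColumn A u ≤ i.val} => i.1)) := by
      rw [ySpace, Set.image_eq_range]
      rfl
    rw [hspan, finrank_span_eq_card (u.linearIndependent.comp _ Subtype.val_injective),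
      Fintype.card_subtype]
    have h := Finset.card_filter_add_card_filter_not (s := (Finset.univ : Finset (Fin n)))
      (fun i => i.val < lastColumn A u)
    have hle := lastColumn_le (A := A) (u := u)
    simp only [not_lt, Fin.card_filter_val_lt, Finset.card_univ, Fintype.card_fin] at h
    omega
  rw [h2, Module.finrank_eq_card_basis u, Fintype.card_fin] at h1
  have := lastColumn_le (A := A) (u := u)
  change Module.finrank ℂ (ySpace A u).dualAnnihilator = _
  omega

/-- Over every covector on `U` there is a rank one element of an involutive tableau. -/
theorem IsInvolutive.exists_smulRight_mem (hA : IsInvolutive A) (hu : IsGenericBasis A u)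
    (hl : 0 < lastColumn A u) (φ : Module.Dual ℂ V) :
    ∃ (ξ : Module.Dual ℂ V) (w : W), w ≠ 0 ∧
      (∀ i : Fin n, i.val < lastColumn A u → ξ (u i) = φ (u i)) ∧ ξ.smulRight w ∈ A := by
  obtain ⟨z, h, -⟩ := exists_endovolutive hA hu
  obtain ⟨m, hml, hm, h0⟩ := exists_last hl
  obtain ⟨ξ, w, hw, hξ, hwA⟩ := exists_smulRight_mem_over h (hA.cartan_test hu) m hm h0 φ
  exact ⟨ξ, w, hw, fun i hi => hξ i (Fin.le_def.2 (by omega)), hwA⟩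

/-! ### Common eigenvectors of the symbol endomorphisms -/

omit [FiniteDimensional ℂ V] [FiniteDimensional ℂ W] in
theorem symbolEnd_eq_sum (h : IsGenericPair A u z) (φ : Module.Dual ℂ V) (v : V) (w : W) :
    symbolEnd h φ v w = ∑ l, φ (u l) • symbolEnd h (u.coord l) v w := by
  have hfill : fill h φ w = ∑ l, φ (u l) • fill h (u.coord l) w := by
    apply h.bijective.1
    simp only [map_sum, map_smul, upperLeft_fill]
    funext p
    simp [Finset.sum_apply, Finsupp.single_apply]
  change (fill h φ w).1 v = _
  rw [hfill, Submodule.coe_sum, LinearMap.sum_apply]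
  rfl

omit [FiniteDimensional ℂ V] [FiniteDimensional ℂ W] in
-- Let `l` be the first index with `φ_l ≠ 0`. Then `φ_l w = B(φ)(u_l) w` is a sum of terms `φ_m
-- B(u^m)(u_l) w` with `m ≥ l`. Endovolutivity and `s_m ≤ s_l` put each of them in the span of the
-- first `s_l` basis vectors.
theorem mem_wOne_of_smulRight_mem (hC : Antitone (characters A u)) {h : IsGenericPair A u z}
    (hend : IsEndovolutive h) {φ ξ : Module.Dual ℂ V} (hφ : φ ∈ yPerp A u) {w : W}
    (hA : ξ.smulRight w ∈ A)
    (hξ : ∀ i : Fin n, i.val < lastColumn A u → ξ (u i) = φ (u i)) : w ∈ wOne h φ := by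
  have hB := symbolEnd_eq_smul h hA (φ := φ) fun i hi => (hξ i (lt_lastColumn_of_pos hi)).symm
  refine ⟨?_, ?_⟩
  · refine (Submodule.mem_iInf _).2 fun l => (Submodule.mem_iInf _).2 fun hl => ?_
    have hll : l.val < lastColumn A u := by
      by_contra hll
      exact hl.1 (mem_yPerp.1 hφ l (not_lt.1 hll))
    have h1 := hB (u l)
    rw [hξ l hll] at h1
    have h2 : symbolEnd h φ (u l) w ∈ initialSpan z (characters A u l) := by
      rw [symbolEnd_eq_sum]
      refine Submodule.sum_mem _ fun m _ => ?_
      rcases lt_or_ge m l with hml | hml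
      · rw [hl.2 m hml, zero_smul]
        exact Submodule.zero_mem _
      · exact Submodule.smul_mem _ _ (initialSpan_mono z (hC hml) (hend m l w))
    rw [h1] at h2
    exact (Submodule.smul_mem_iff _ hl.1).1 h2
  · refine (Submodule.mem_iInf _).2 fun m => (Submodule.mem_iInf _).2 fun hm => ?_
    rw [LinearMap.mem_ker, LinearMap.sub_apply, hB, hξ m hm]
    exact sub_self _

theorem IsInvolutive.exists_mem_wOne (hA : IsInvolutive A) {h : IsGenericPair A u z}
    (hend : IsEndovolutive h) {φ : Module.Dual ℂ V} (hφ : φ ∈ yPerp A u) (h0 : φ ≠ 0) :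
    ∃ w ∈ wOne h φ, ∀ v : V, ∃ c : ℂ, (symbolEnd h φ v).HasEigenvector c w := by
  obtain ⟨ξ, w, hw, hξ, hwA⟩ := hA.exists_smulRight_mem h.generic (lastColumn_pos hφ h0) φ
  refine ⟨w, mem_wOne_of_smulRight_mem (characters_antitone (hA.cartan_test h.generic)) hend hφ hwA
    hξ, fun v => ⟨ξ v, Module.End.mem_eigenspace_iff.2 ?_, hw⟩⟩
  exact symbolEnd_eq_smul h hwA (fun i hi => (hξ i (lt_lastColumn_of_pos hi)).symm) v

end Tableau

end

noncomputable section

/-! ### The projection of the characteristic variety -/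

namespace Tableau

open ProjectiveCover

variable {V : Type*} {W : Type*} [AddCommGroup V] [Module ℂ V] [AddCommGroup W] [Module ℂ W]
  {A : Submodule ℂ (V →ₗ[ℂ] W)} {n r : ℕ} {u : Module.Basis (Fin n) ℂ V}
  {z : Module.Basis (Fin r) ℂ W}

theorem smul_smulRight_mem_iff {c : ℂ} (hc : c ≠ 0) {ξ : Module.Dual ℂ V} {w : W} :
    (c • ξ).smulRight w ∈ A ↔ ξ.smulRight w ∈ A := by
  have : (c • ξ).smulRight w = c • ξ.smulRight w := by
    ext v
    simp [mul_smul]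
  rw [this]
  exact Submodule.smul_mem_iff A hc

theorem mk_mem_charVariety {ξ : Module.Dual ℂ V} (h0 : ξ ≠ 0) :
    Projectivization.mk ℂ ξ h0 ∈ charVariety A ↔ ∃ w : W, w ≠ 0 ∧ ξ.smulRight w ∈ A := by
  obtain ⟨c, hc⟩ := Projectivization.exists_smul_eq_mk_rep ℂ ξ h0
  have hc' : (c : ℂ) • ξ = (Projectivization.mk ℂ ξ h0).rep := hc
  change (∃ w : W, w ≠ 0 ∧ (Projectivization.mk ℂ ξ h0).rep.smulRight w ∈ A) ↔ _
  simp only [← hc', smul_smulRight_mem_iff c.ne_zero]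

theorem mem_affineCone_charVariety {ξ : Module.Dual ℂ V} :
    ξ ∈ affineCone (charVariety A) ↔ ξ ≠ 0 → ∃ w : W, w ≠ 0 ∧ ξ.smulRight w ∈ A :=
  forall_congr' fun h0 => mk_mem_charVariety h0

theorem symbolEnd_dualProj (h : IsGenericPair A u z) {ξ : Module.Dual ℂ V} {w : W}
    (hA : ξ.smulRight w ∈ A) (v : V) : symbolEnd h (dualProj A u ξ).1 v w = ξ v • w :=
  symbolEnd_eq_smul h hA (fun i hi => by rw [dualProj_apply, if_pos (lt_lastColumn_of_pos hi)]) v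

theorem avoidsKernel (h : IsGenericPair A u z) :
    AvoidsKernel (charVariety A) (dualProj A u) := by
  rintro p ⟨w, hw, hA⟩ h0
  refine p.rep_nonzero (LinearMap.ext fun v => ?_)
  have h1 := symbolEnd_dualProj h hA v
  -- Additivity at zero gives `B(0) = 0`, so `ξ(v) w = 0` for every `v`.
  have h2 := symbolEnd_add_smul h (dualProj A u p.rep).1 (dualProj A u p.rep).1 1 v w
  rw [h0] at h1 h2
  simp only [ZeroMemClass.coe_zero, smul_zero, add_zero, one_smul, left_eq_add] at h2
  simp only [ZeroMemClass.coe_zero] at h1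
  rw [h2] at h1
  exact (smul_eq_zero.1 h1.symm).resolve_right hw

/-- An entry of the symbol endomorphism, as a linear function of the covector. -/
def symbolEntry (h : IsGenericPair A u z) (v : V) (a b : Fin r) :
    Module.Dual ℂ (yPerp A u) where
  toFun φ := z.coord a (symbolEnd h φ.1 v (z b))
  map_add' φ ψ := by
    have := symbolEnd_add_smul h φ.1 ψ.1 1 v (z b)
    rw [one_smul, one_smul] at this
    rw [Submodule.coe_add, this, map_add]
  map_smul' c φ := by
    have h1 := symbolEnd_add_smul h 0 φ.1 c v (z b)
    have h2 := symbolEnd_add_smul h 0 0 1 v (z b)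
    simp only [smul_zero, add_zero, one_smul, left_eq_add] at h2
    rw [h2, zero_add, zero_add] at h1
    rw [Submodule.coe_smul, h1, map_smul, RingHom.id_apply]

variable [FiniteDimensional ℂ V] [FiniteDimensional ℂ W]

/-- The coordinates of the characteristic variety are integral over the coordinates of `Y^⊥`. -/
theorem pullback_dualProj_finite (h : IsGenericPair A u z) {X : Set (Module.Dual ℂ V)}
    {Y : Set (yPerp A u)} (hXY : Set.MapsTo (dualProj A u) X Y)
    (hX : X ⊆ affineCone (charVariety A)) : (pullback (dualProj A u) hXY).toRingHom.Finite := by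
  refine pullback_finite hXY u.dualBasis.dualBasis fun i => ?_
  let M : Matrix (Fin r) (Fin r) (polyFun Y) := Matrix.of fun a b =>
    linearFun Y (symbolEntry h (u i) a b)
  -- The factor `X` covers points with `ξ (u i) = 0`, in particular the apex of the cone, where no
  -- eigenvector need exist. Elsewhere `ξ (u i)` is an eigenvalue of `M` evaluated at the image
  -- point.
  refine ⟨Polynomial.X * M.charpoly, Polynomial.monic_X.mul M.charpoly_monic, ?_⟩
  refine Subtype.ext (funext fun x => ?_)
  obtain ⟨ξ, hξ⟩ := x
  let y : Y := ⟨dualProj A u ξ, hXY hξ⟩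
  change evalAt X ⟨ξ, hξ⟩ _ = 0
  have hcomp : ((evalAt X ⟨ξ, hξ⟩ : polyFun X →ₐ[ℂ] ℂ) : polyFun X →+* ℂ).comp
      (pullback (dualProj A u) hXY).toRingHom = (evalAt Y y : polyFun Y →ₐ[ℂ] ℂ) := rfl
  have hM : M.map ((evalAt Y y : polyFun Y →ₐ[ℂ] ℂ) : polyFun Y →+* ℂ) =
      LinearMap.toMatrix z z (symbolEnd h (dualProj A u ξ).1 (u i)) := by
    ext a b
    rw [LinearMap.toMatrix_apply]
    rfl
  have hval : evalAt X ⟨ξ, hξ⟩ (linearFun X (u.dualBasis.dualBasis i)) = ξ (u i) := by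
    simp
  have heval := Polynomial.hom_eval₂ (Polynomial.X * M.charpoly)
    (pullback (dualProj A u) hXY).toRingHom
    ((evalAt X ⟨ξ, hξ⟩ : polyFun X →ₐ[ℂ] ℂ) : polyFun X →+* ℂ)
    (linearFun X (u.dualBasis.dualBasis i))
  refine heval.trans ?_
  rw [hcomp, RingHom.coe_coe, hval, Polynomial.eval₂_mul, Polynomial.eval₂_X, ← Polynomial.eval_map,
    ← Matrix.charpoly_map, hM, LinearMap.charpoly_toMatrix, mul_eq_zero, or_iff_not_imp_left]
  intro hξ0
  obtain ⟨w, hw, hA⟩ := mem_affineCone_charVariety.1 (hX hξ) fun h0 => hξ0 (by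
    rw [h0, LinearMap.zero_apply])
  exact (Module.End.hasEigenvalue_iff_isRoot_charpoly _ _).1
    (Module.End.hasEigenvalue_of_hasEigenvector
      ⟨Module.End.mem_eigenspace_iff.2 (symbolEnd_dualProj h hA (u i)), hw⟩)

omit [FiniteDimensional ℂ V] in
-- Each coordinate `ξ (u i)` is one of the finitely many eigenvalues of `B(φ)(u i)`.
theorem finite_fiber_dualProj (h : IsGenericPair A u z) (φ : yPerp A u) :
    {ξ : Module.Dual ℂ V | (∃ w : W, w ≠ 0 ∧ ξ.smulRight w ∈ A) ∧ dualProj A u ξ = φ}.Finite := by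
  have hfin : (Set.univ.pi fun i : Fin n =>
      {μ : ℂ | (symbolEnd h φ.1 (u i)).HasEigenvalue μ}).Finite :=
    Set.Finite.pi fun i => Module.End.finite_hasEigenvalue _
  refine Set.Finite.of_finite_image (f := fun ξ i => ξ (u i)) (hfin.subset ?_) ?_
  · rintro _ ⟨ξ, ⟨⟨w, hw, hA⟩, rfl⟩, rfl⟩ i -
    exact Module.End.hasEigenvalue_of_hasEigenvector
      ⟨Module.End.mem_eigenspace_iff.2 (symbolEnd_dualProj h hA (u i)), hw⟩
  · intro ξ _ ξ' _ hξ
    exact u.ext fun i => congrFun hξ i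

theorem IsInvolutive.surjOn_dualProj (hA : IsInvolutive A) (hu : IsGenericBasis A u) :
    Set.SurjOn (dualProj A u) (affineCone (charVariety A)) Set.univ := by
  rintro ⟨φ, hφ⟩ -
  by_cases h0 : φ = 0
  · subst h0
    exact ⟨0, fun h => absurd rfl h, map_zero _⟩
  · obtain ⟨ξ, w, hw, hξ, hwA⟩ := hA.exists_smulRight_mem hu (lastColumn_pos hφ h0) φ
    exact ⟨ξ, mem_affineCone_charVariety.2 fun _ => ⟨w, hw, hwA⟩, dualProj_eq hφ hξ⟩

theorem IsInvolutive.isFiniteBranchedCover (hA : IsInvolutive A) (h : IsGenericPair A u z) :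
    IsFiniteBranchedCover (avoidsKernel h) where
  surjective q := by
    obtain ⟨ξ, hξ, hξq⟩ := hA.surjOn_dualProj h.generic (Set.mem_univ q.rep)
    have h0 : ξ ≠ 0 := by
      rintro rfl
      exact q.rep_nonzero (hξq.symm.trans (map_zero _))
    refine ⟨⟨Projectivization.mk ℂ ξ h0, hξ h0⟩, ?_⟩
    obtain ⟨c, hc⟩ := Projectivization.exists_smul_eq_mk_rep ℂ ξ h0
    rw [← q.mk_rep, linearProjection, Projectivization.mk_eq_mk_iff]
    refine ⟨c, ?_⟩
    change c • q.rep = dualProj A u (Projectivization.mk ℂ ξ h0).rep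
    rw [← hc, ← hξq]
    exact (map_smul (dualProj A u) (c : ℂ) ξ).symm
  finite_fibers q := by
    -- Each point of the fibre is rescaled to lie exactly over `q.rep`, which embeds the fibre into
    -- a finite linear one.
    have hex : ∀ p : linearProjection (avoidsKernel h) ⁻¹' {q}, ∃ ξ : {ξ : Module.Dual ℂ V |
        (∃ w : W, w ≠ 0 ∧ ξ.smulRight w ∈ A) ∧ dualProj A u ξ = q.rep},
        ∃ h0 : ξ.1 ≠ 0, Projectivization.mk ℂ ξ.1 h0 = p.1.1 := by
      rintro ⟨p, hp⟩
      have hp' : Projectivization.mk ℂ _ (avoidsKernel h p.1 p.2) =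
        Projectivization.mk ℂ q.rep q.rep_nonzero := hp.trans q.mk_rep.symm
      obtain ⟨c, hc⟩ := (Projectivization.mk_eq_mk_iff ℂ _ _ _ _).1 hp'
      have hc' : (c : ℂ) • q.rep = dualProj A u p.1.rep := hc
      obtain ⟨w, hw, hwA⟩ := p.2
      refine ⟨⟨(c : ℂ)⁻¹ • p.1.rep, ⟨w, hw, ?_⟩, ?_⟩, ?_, ?_⟩
      · exact (smul_smulRight_mem_iff (inv_ne_zero c.ne_zero)).2 hwA
      · rw [map_smul, ← hc', inv_smul_smul₀ c.ne_zero]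
      · exact smul_ne_zero (inv_ne_zero c.ne_zero) p.1.rep_nonzero
      · refine Eq.trans ?_ p.1.mk_rep
        rw [Projectivization.mk_eq_mk_iff]
        exact ⟨c⁻¹, by rw [Units.smul_def, Units.val_inv_eq_inv_val]⟩
    choose f hf0 hf using hex
    have : Finite {ξ : Module.Dual ℂ V |
        (∃ w : W, w ≠ 0 ∧ ξ.smulRight w ∈ A) ∧ dualProj A u ξ = q.rep} :=
      (finite_fiber_dualProj h q.rep).to_subtype
    have hinj : Function.Injective f := by
      intro p p' hpp
      apply Subtype.ext
      apply Subtype.ext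
      rw [← hf p, ← hf p']
      congr 2
    exact Set.finite_coe_iff.1 (Finite.of_injective f hinj)
  finite l _ := pullback_dualProj_finite h _ fun _ hx => hx.1
  generically_etale l hl := by
    obtain ⟨_, _⟩ := isDomain_polyFun_chart_univ hl
    exact RingHom.Finite.exists_etale_awayMap _ (pullback_dualProj_finite h _ fun _ hx => hx.1)

theorem IsInvolutive.ringKrullDim_affineCone (hA : IsInvolutive A) (h : IsGenericPair A u z) :
    ringKrullDim (polyFun (affineCone (charVariety A))) = lastColumn A u := by
  have hmaps : Set.MapsTo (dualProj A u) (affineCone (charVariety A)) Set.univ :=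
    Set.mapsTo_univ _ _
  rw [RingHom.IsIntegral.ringKrullDim_eq (pullback (dualProj A u) hmaps).toRingHom
    (pullback_dualProj_finite h hmaps subset_rfl).to_isIntegral
    (pullback_injective hmaps (hA.surjOn_dualProj h.generic)), ringKrullDim_polyFun_univ,
    finrank_yPerp]

/-- Since `∑ s_i = dim A`, some character is positive; a rank one element then lies over a nonzero
covector of `Y^⊥`. -/
theorem IsInvolutive.charVariety_nonempty (hA : IsInvolutive A) (h0 : A ≠ ⊥) :
    (charVariety A).Nonempty := by
  obtain ⟨n, u, hu, -⟩ := id hA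
  have hl : 0 < lastColumn A u := by
    by_contra hl
    refine h0 (Submodule.finrank_eq_zero.1 ?_)
    rw [← sum_characters (A := A) (u := u)]
    refine Finset.sum_eq_zero fun i _ => ?_
    by_contra hi
    exact hl ((Nat.zero_le _).trans_lt (lt_lastColumn_of_pos (Nat.pos_of_ne_zero hi)))
  obtain ⟨m, hm, -⟩ := exists_last hl
  obtain ⟨ξ, w, hw, hξ, hwA⟩ := hA.exists_smulRight_mem hu hl (u.coord m)
  have hξ0 : ξ ≠ 0 := by
    rintro rfl
    have := hξ m (by omega)
    simp at this
  exact ⟨_, (mk_mem_charVariety hξ0).2 ⟨w, hw, hwA⟩⟩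

end Tableau

end

theorem mainTheorem6 {V : Type*} {W : Type*}
    [AddCommGroup V] [Module ℂ V] [FiniteDimensional ℂ V]
    [AddCommGroup W] [Module ℂ W] [FiniteDimensional ℂ W]
    (A : Submodule ℂ (V →ₗ[ℂ] W)) (hA : Tableau.IsInvolutive A) :
    (A ≠ ⊥ → (Tableau.charVariety A).Nonempty) ∧
    ∀ (n : ℕ) (u : Module.Basis (Fin n) ℂ V), Tableau.IsGenericBasis A u →
      (∃ (z : Module.Basis (Fin (Module.finrank ℂ W)) ℂ W) (h : Tableau.IsGenericPair A u z),
        Tableau.IsEndovolutive h) ∧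
      (∀ (r : ℕ) (z : Module.Basis (Fin r) ℂ W) (h : Tableau.IsGenericPair A u z),
        Tableau.IsEndovolutive h →
        ∀ φ ∈ Tableau.yPerp A u, φ ≠ 0 →
          ∃ w ∈ Tableau.wOne h φ,
            ∀ v : V, ∃ c : ℂ, (Tableau.symbolEnd h φ v).HasEigenvector c w) ∧
      (∃ hc : ProjectiveCover.AvoidsKernel (Tableau.charVariety A) (Tableau.dualProj A u),
        ProjectiveCover.IsFiniteBranchedCover hc) ∧
      Module.finrank ℂ (Tableau.yPerp A u) = Tableau.lastColumn A u ∧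
      ringKrullDim (ProjectiveCover.polyFun
        (ProjectiveCover.affineCone (Tableau.charVariety A))) = Tableau.lastColumn A u := by
  refine ⟨hA.charVariety_nonempty, fun n u hu => ?_⟩
  -- The cover and the dimension of the cone do not depend on `z`, but their proofs use the matrices
  -- of the symbol endomorphisms in some generic pair.
  obtain ⟨z, h, hend⟩ := Tableau.exists_endovolutive hA hu
  exact ⟨⟨z, h, hend⟩, fun r z' h' hend' φ hφ h0 => hA.exists_mem_wOne hend' hφ h0,
    ⟨Tableau.avoidsKernel h, hA.isFiniteBranchedCover h⟩, Tableau.finrank_yPerp,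
    hA.ringKrullDim_affineCone h⟩
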